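/- Let $n\ge 0$ and $k\ge 1$ be integers, and let $H$ be an $n$-qubit $k$-local Hamiltonian, i.e. a Hermitian operator on $(\mathbb{C}^2)^{\otimes n}$ of the form $$H=\sum_{P\in\{I,X,Y,Z\}^{\otimes n}:\ |P|\le k}\alpha_P P,$$ where $I,X,Y,Z$ are the single-qubit Pauli matrices and the weight $|P|$ is the number of qubits on which $P$ acts nontrivially. For $p\ge 1$ let $\|H\|_{\mathrm{Pauli},p}=\big(\sum_{P}|\alpha_P|^p\big)^{1/p}$ be the $\ell_p$ norm of the Pauli coefficients $\alpha_P=2^{-n}\operatorname{Tr}(PH)$ of $H$, and let $\|H\|$ be the spectral norm of $H$. Then $$\frac13\,C(k)\,\|H\|_{\mathrm{Pauli},\frac{2k}{k+1}}\le\|H\|,\qquad\text{where}\quad C(k)=\frac{\sqrt{2(k!)}}{2\,k^{\,k+\frac32+\frac{k+1}{2k}}\,(\sqrt6+2\sqrt3)^k}.$$ Moreover, $C(k)=1/\exp(\Theta(k\log k))$ as $k\to\infty$. -/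

import Mathlib

/-- Labels of the four single-qubit Pauli matrices. -/
inductive Pauli where
  | I
  | X
  | Y
  | Z
  deriving DecidableEq

instance : Fintype Pauli where
  elems := {Pauli.I, Pauli.X, Pauli.Y, Pauli.Z}
  complete := by intro p; cases p <;> simp

/-- The single-qubit Pauli matrices. -/
def Pauli.toMatrix : Pauli → Matrix (Fin 2) (Fin 2) ℂ
  | Pauli.I => !![1, 0; 0, 1]
  | Pauli.X => !![0, 1; 1, 0]
  | Pauli.Y => !![0, -Complex.I; Complex.I, 0]
  | Pauli.Z => !![1, 0; 0, -1]

/-- Labels of the elements of `{I, X, Y, Z}^{⊗ n}`. -/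
abbrev PauliString (n : ℕ) : Type := Fin n → Pauli

/-- Operators on `n` qubits, as matrices in the computational basis, which is indexed by
bit strings of length `n`. -/
abbrev QubitOp (n : ℕ) : Type := Matrix (Fin n → Fin 2) (Fin n → Fin 2) ℂ

namespace PauliString

/-- The tensor product `P 0 ⊗ ⋯ ⊗ P (n - 1)`: its entries are the products of the entries of
the factors. -/
def toMatrix {n : ℕ} (P : PauliString n) : QubitOp n :=
  Matrix.of fun a b => ∏ q, (P q).toMatrix (a q) (b q)

/-- The number of qubits on which `P` acts nontrivially. -/
def weight {n : ℕ} (P : PauliString n) : ℕ :=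
  (Finset.univ.filter fun q => P q ≠ Pauli.I).card

end PauliString

/-- `H` is an `n`-qubit `k`-local Hamiltonian: a Hermitian operator that is a linear combination
of Pauli operators of weight at most `k`. -/
def IsLocalHamiltonian {n : ℕ} (k : ℕ) (H : QubitOp n) : Prop :=
  H.IsHermitian ∧ ∃ α : PauliString n → ℂ,
    H = ∑ P ∈ Finset.univ.filter (fun P : PauliString n => P.weight ≤ k), α P • P.toMatrix

/-- The coefficient of `P` in the Pauli expansion of `H`, that is `Tr (P H) / 2 ^ n`. -/
noncomputable def pauliCoeff {n : ℕ} (H : QubitOp n) (P : PauliString n) : ℂ :=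
  (P.toMatrix * H).trace / 2 ^ n

/-- The `ℓ_p` norm of the Pauli coefficients of `H`. -/
noncomputable def pauliNorm {n : ℕ} (p : ℝ) (H : QubitOp n) : ℝ :=
  (∑ P : PauliString n, ‖pauliCoeff H P‖ ^ p) ^ (1 / p)

/-- The spectral norm: the operator norm on `ℂ^(2^n)` with its Euclidean norm. -/
noncomputable def spectralNormOp {n : ℕ} (H : QubitOp n) : ℝ :=
  ‖Matrix.toEuclideanCLM (n := Fin n → Fin 2) (𝕜 := ℂ) H‖

/-- `C(k) = √(2 k!) / (2 k^(k + 3/2 + (k+1)/(2k)) (√6 + 2√3)^k)`. -/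
noncomputable def bhConst (k : ℕ) : ℝ :=
  √(2 * (k.factorial : ℝ)) /
    (2 * (k : ℝ) ^ ((k : ℝ) + 3 / 2 + ((k : ℝ) + 1) / (2 * (k : ℝ))) * (√6 + 2 * √3) ^ k)

/-- Pauli operators are orthogonal for the trace form. -/
theorem PauliString.trace_mul {n : ℕ} (P Q : PauliString n) :
    (P.toMatrix * Q.toMatrix).trace = if P = Q then 2 ^ n else 0 := by
  have h1 : ∀ p q : Pauli, ∑ a : Fin 2, ∑ b : Fin 2, p.toMatrix a b * q.toMatrix b a
      = if p = q then 2 else 0 := by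
    intro p q
    cases p <;> cases q <;> simp [Pauli.toMatrix] <;> norm_num
  have h2 : (P.toMatrix * Q.toMatrix).trace
      = ∏ q, ∑ a : Fin 2, ∑ b : Fin 2, (P q).toMatrix a b * (Q q).toMatrix b a := by
    simp only [Finset.prod_univ_sum, Fintype.piFinset_univ]
    simp only [Matrix.trace, Matrix.diag, Matrix.mul_apply, PauliString.toMatrix, Matrix.of_apply,
      Finset.prod_mul_distrib]
  rw [h2]
  simp only [h1]
  split_ifs with h
  · subst h; simp
  · obtain ⟨q, hq⟩ := Function.ne_iff.mp h
    exact Finset.prod_eq_zero (Finset.mem_univ q) (by simp [hq])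

/-- The coefficients of a Pauli expansion are determined by the operator. -/
theorem pauliCoeff_sum {n : ℕ} (α : PauliString n → ℂ) (P : PauliString n) :
    pauliCoeff (∑ Q, α Q • Q.toMatrix) P = α P := by
  simp [pauliCoeff, Finset.mul_sum, Matrix.trace_sum, PauliString.trace_mul]

/-- Every operator is the sum of its Pauli expansion. -/
theorem sum_pauliCoeff {n : ℕ} (H : QubitOp n) :
    ∑ P : PauliString n, pauliCoeff H P • P.toMatrix = H := by
  have h1 : ∀ a b c d : Fin 2, ∑ p : Pauli, p.toMatrix c d * p.toMatrix a b
      = if d = a ∧ c = b then 2 else 0 := by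
    intro a b c d
    have hu : (Finset.univ : Finset Pauli) = {Pauli.I, Pauli.X, Pauli.Y, Pauli.Z} := rfl
    fin_cases a <;> fin_cases b <;> fin_cases c <;> fin_cases d <;>
      simp [hu, Pauli.toMatrix] <;> norm_num
  have h2 : ∀ a b c d : Fin n → Fin 2,
      ∑ P : PauliString n, P.toMatrix c d * P.toMatrix a b
      = if d = a ∧ c = b then 2 ^ n else 0 := by
    intro a b c d
    simp only [PauliString.toMatrix, Matrix.of_apply, ← Finset.prod_mul_distrib]
    have := Finset.prod_univ_sum (fun _ : Fin n => (Finset.univ : Finset Pauli))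
      (fun q p => p.toMatrix (c q) (d q) * p.toMatrix (a q) (b q))
    rw [Fintype.piFinset_univ] at this
    rw [← this]
    simp only [h1]
    split_ifs with h
    · obtain ⟨rfl, rfl⟩ := h; simp
    · have : ∃ q, ¬ (d q = a q ∧ c q = b q) := by
        by_contra hc
        push Not at hc
        exact h ⟨funext fun q => (hc q).1, funext fun q => (hc q).2⟩
      obtain ⟨q, hq⟩ := this
      exact Finset.prod_eq_zero (Finset.mem_univ q) (by simp [hq])
  ext a b
  have h3 : (∑ P : PauliString n, pauliCoeff H P • P.toMatrix) a b
      = ∑ c, ∑ d, (H d c / 2 ^ n) * ∑ P : PauliString n, P.toMatrix c d * P.toMatrix a b := by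
    simp only [Matrix.sum_apply, Matrix.smul_apply, smul_eq_mul, pauliCoeff, Matrix.trace,
      Matrix.diag, Matrix.mul_apply, Finset.sum_div, Finset.sum_mul, Finset.mul_sum]
    rw [Finset.sum_comm]
    refine Finset.sum_congr rfl fun c _ => ?_
    rw [Finset.sum_comm]
    refine Finset.sum_congr rfl fun d _ => Finset.sum_congr rfl fun P _ => ?_
    ring
  rw [h3]
  simp only [h2, ite_and]
  simp [Finset.sum_ite_eq']

/-!
The expectation of a `k`-local `H` in a product state is a polynomial of degree at most `k` in the
Bloch vectors of the qubits, affine in each of them, whose coefficients are the Pauli coefficients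
of `H`. It is bounded by the spectral norm on Bloch vectors `t / √3` times a sign vector, for
`|t| ≤ 1` (`norm_sum_pauliCoeff_mul_le`). This reduces the theorem to a Bohnenblust–Hille
inequality for real polynomials on a sign cube, at the cost of a factor `√3 ^ m` in degree `m`.

As a polynomial in `t`, the expectation has degree at most `k`, so its homogeneous parts are
bounded by `2 ^ k * k ^ k / k!` times the spectral norm (`abs_coeff_le_of_abs_eval_le`). The part of
degree `m` is decoupled by colouring the qubits with `m` colours: averaging over one random sign per
colour leaves exactly the strings with one qubit of each colour, and on these the polynomial is an
`m`-linear form (`abs_sum_rainbow_le`). A given string of weight `m` is of this kind for a fraction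
`m! / m ^ m` of the colourings, so that averaging the multilinear inequality over the colourings
costs only the factor `m ^ m / m!` inside the `p`-th power (`factorial_mul_sum_weight_eq_le`).

The multilinear inequality (`bohnenblustHille_multilinear`) has two ingredients. The Khintchine
inequality with constant `√2` (`khintchine`) holds because `f x = ‖∑ i, x i • v i‖` is even and
satisfies `∑ i, f (x with sign i reversed) ≥ (n - 2) f x`, while the spectral gap of the discrete
Laplacian on even functions is twice the usual one. It bounds the mixed `ℓ₁(ℓ₂)` norms of the
coefficients, and the inequality between geometric and arithmetic means turns these bounds into an
`ℓ_p` bound (`sum_rpow_le_one_of_mixed`).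

The resulting constant is `(k + 1) (k ^ k / k!) √6 ^ k (2 ^ k k ^ k / k!)`, which is at most
`3 / C(k)` because `k ^ (2 k) ≤ 4 k² (k!)³` (`bhConst_mul_le`).
-/

/-! ### Rademacher sums and the Khintchine inequality -/

/-- The Walsh character `x ↦ ∏ i ∈ S, x i` of the sign cube. -/
def walsh {ι : Type*} (S : Finset ι) (x : ι → ℤˣ) : ℝ := ∏ i ∈ S, ((x i : ℤ) : ℝ)

/-- The sign vector `x` with the sign at `i` reversed. -/
def flipSign {ι : Type*} [DecidableEq ι] (i : ι) (x : ι → ℤˣ) : ι → ℤˣ :=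
  Function.update x i (-x i)

/-- The Walsh coefficient of `f` at `S`, without the normalisation `2 ^ (-n)`. -/
def walshSum {ι : Type*} [Fintype ι] [DecidableEq ι] (f : (ι → ℤˣ) → ℝ) (S : Finset ι) : ℝ :=
  ∑ x, f x * walsh S x

section Khintchine

variable {ι : Type*}

lemma units_cast_mul_self (u : ℤˣ) : ((u : ℤ) : ℝ) * ((u : ℤ) : ℝ) = 1 := by
  rcases Int.units_eq_one_or u with h | h <;> simp [h]

lemma walsh_neg (S : Finset ι) (x : ι → ℤˣ) : walsh S (-x) = (-1) ^ S.card * walsh S x := by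
  simp [walsh, Finset.prod_neg]

lemma sum_walsh_mul_walsh [Fintype ι] (x y : ι → ℤˣ) :
    ∑ S : Finset ι, walsh S x * walsh S y = if x = y then 2 ^ Fintype.card ι else 0 := by
  have h := Finset.prod_one_add (R := ℝ) (s := (Finset.univ : Finset ι))
    (f := fun i => ((x i : ℤ) : ℝ) * ((y i : ℤ) : ℝ))
  rw [Finset.powerset_univ] at h
  simp only [walsh, ← Finset.prod_mul_distrib]
  rw [← h]
  split_ifs with hxy
  · subst hxy
    simp [units_cast_mul_self, one_add_one_eq_two]
  · obtain ⟨i, hi⟩ := Function.ne_iff.mp hxy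
    refine Finset.prod_eq_zero (Finset.mem_univ i) ?_
    rcases Int.units_eq_one_or (x i) with h1 | h1 <;>
      rcases Int.units_eq_one_or (y i) with h2 | h2 <;> simp_all

variable [DecidableEq ι]

lemma flipSign_involutive (i : ι) : Function.Involutive (flipSign i) := by
  intro x
  ext j
  by_cases h : j = i
  · subst h; simp [flipSign]
  · simp [flipSign, h]

lemma walsh_flipSign (i : ι) (S : Finset ι) (x : ι → ℤˣ) :
    walsh S (flipSign i x) = (if i ∈ S then -1 else 1) * walsh S x := by
  have h : ∀ j, ((flipSign i x j : ℤ) : ℝ) = (if j = i then -1 else 1) * ((x j : ℤ) : ℝ) := by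
    intro j
    by_cases h : j = i
    · subst h; simp [flipSign]
    · simp [flipSign, h]
  simp only [walsh, h, Finset.prod_mul_distrib, Finset.prod_ite_eq']

variable [Fintype ι]

/-- Parseval's identity on the sign cube. -/
lemma sum_walshSum_mul_walshSum (f g : (ι → ℤˣ) → ℝ) :
    ∑ S, walshSum f S * walshSum g S = 2 ^ Fintype.card ι * ∑ x, f x * g x := by
  calc ∑ S, walshSum f S * walshSum g S
      = ∑ S, ∑ x, ∑ y, f x * g y * (walsh S x * walsh S y) := by
        refine Finset.sum_congr rfl fun S _ => ?_
        rw [walshSum, walshSum, Finset.sum_mul_sum]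
        exact Finset.sum_congr rfl fun x _ => Finset.sum_congr rfl fun y _ => by ring
    _ = ∑ x, ∑ y, f x * g y * ∑ S, walsh S x * walsh S y := by
        rw [Finset.sum_comm]
        refine Finset.sum_congr rfl fun x _ => ?_
        rw [Finset.sum_comm]
        simp only [Finset.mul_sum]
    _ = _ := by
        simp only [sum_walsh_mul_walsh, mul_ite, mul_zero, Finset.sum_ite_eq, Finset.mem_univ,
          if_true, Finset.mul_sum]
        exact Finset.sum_congr rfl fun x _ => by ring

lemma walshSum_comp_flipSign (f : (ι → ℤˣ) → ℝ) (i : ι) (S : Finset ι) :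
    walshSum (fun x => f (flipSign i x)) S = (if i ∈ S then -1 else 1) * walshSum f S := by
  rw [walshSum, walshSum, ← Equiv.sum_comp (flipSign_involutive i).toPerm, Finset.mul_sum]
  refine Finset.sum_congr rfl fun x _ => ?_
  simp only [Function.Involutive.coe_toPerm, flipSign_involutive i x, walsh_flipSign]
  ring

lemma walshSum_eq_zero_of_even (f : (ι → ℤˣ) → ℝ) (hf : ∀ x, f (-x) = f x) (S : Finset ι)
    (hS : Odd S.card) : walshSum f S = 0 := by
  have h : walshSum f S = -walshSum f S := by
    conv_lhs => rw [walshSum, ← Equiv.sum_comp (Equiv.neg (ι → ℤˣ))]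
    simp [walshSum, hf, walsh_neg, hS.neg_one_pow]
  linarith

/-- A nonnegative even function on the sign cube that is almost subharmonic satisfies a reverse
Hölder inequality: an even function has no Walsh coefficients of degree one, so that the spectral
gap of the discrete Laplacian on the non-constant part is twice the usual one. -/
lemma sum_sq_le_of_flipSign (f : (ι → ℤˣ) → ℝ) (hf0 : ∀ x, 0 ≤ f x) (hf : ∀ x, f (-x) = f x)
    (hL : ∀ x, ((Fintype.card ι : ℝ) - 2) * f x ≤ ∑ i, f (flipSign i x)) :
    2 ^ Fintype.card ι * ∑ x, f x ^ 2 ≤ 2 * (∑ x, f x) ^ 2 := by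
  set n : ℝ := (Fintype.card ι : ℝ) with hn
  set N : ℝ := 2 ^ Fintype.card ι with hN
  have hNpos : 0 < N := by positivity
  have h1 : (n - 2) * ∑ x, f x ^ 2 ≤ ∑ i, ∑ x, f x * f (flipSign i x) := by
    rw [Finset.sum_comm, Finset.mul_sum]
    refine Finset.sum_le_sum fun x _ => ?_
    rw [← Finset.mul_sum]
    nlinarith [mul_le_mul_of_nonneg_left (hL x) (hf0 x)]
  have h2 : N * ∑ i, ∑ x, f x * f (flipSign i x)
      = ∑ S, (n - 2 * (S.card : ℝ)) * walshSum f S ^ 2 := by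
    have h3 : ∀ S : Finset ι, ∑ i, (if i ∈ S then (-1 : ℝ) else 1) = n - 2 * S.card := by
      intro S
      have : ∀ i, (if i ∈ S then (-1 : ℝ) else 1) = 1 - 2 * (if i ∈ S then 1 else 0) := by
        intro i; split_ifs <;> norm_num
      simp [this, Finset.sum_sub_distrib, hn, mul_comm]
    calc N * ∑ i, ∑ x, f x * f (flipSign i x)
        = ∑ i, ∑ S, walshSum f S * walshSum (fun x => f (flipSign i x)) S := by
          rw [Finset.mul_sum]
          exact Finset.sum_congr rfl fun i _ => (sum_walshSum_mul_walshSum _ _).symm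
      _ = _ := by
          rw [Finset.sum_comm]
          refine Finset.sum_congr rfl fun S _ => ?_
          rw [← h3, Finset.sum_mul]
          refine Finset.sum_congr rfl fun i _ => ?_
          rw [walshSum_comp_flipSign]; ring
  have h4 : ∑ S, (n - 2 * (S.card : ℝ)) * walshSum f S ^ 2
      ≤ (n - 4) * ∑ S, walshSum f S ^ 2 + 4 * walshSum f ∅ ^ 2 := by
    have : 4 * walshSum f ∅ ^ 2
        = ∑ S : Finset ι, if S = ∅ then 4 * walshSum f S ^ 2 else 0 := by
      simp
    rw [this, Finset.mul_sum, ← Finset.sum_add_distrib]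
    refine Finset.sum_le_sum fun S _ => ?_
    split_ifs with hS
    · subst hS; simp; linarith
    · rcases Nat.even_or_odd S.card with he | ho
      · have : 2 ≤ S.card := by
          have := Finset.card_ne_zero.mpr (Finset.nonempty_iff_ne_empty.mpr hS)
          obtain ⟨r, hr⟩ := he
          omega
        have : (2 : ℝ) ≤ S.card := by exact_mod_cast this
        nlinarith [sq_nonneg (walshSum f S)]
      · simp [walshSum_eq_zero_of_even f hf S ho]
  have h5 : ∑ S, walshSum f S ^ 2 = N * ∑ x, f x ^ 2 := by
    simpa [sq] using sum_walshSum_mul_walshSum f f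
  have h6 : walshSum f ∅ = ∑ x, f x := by simp [walshSum, walsh]
  rw [h5, h6] at h4
  have h7 := mul_le_mul_of_nonneg_left h1 hNpos.le
  rw [h2] at h7
  nlinarith

variable {E : Type*} [NormedAddCommGroup E] [InnerProductSpace ℝ E]

lemma sum_sign_mul_sign (i j : ι) :
    ∑ x : ι → ℤˣ, ((x i : ℤ) : ℝ) * ((x j : ℤ) : ℝ) = if i = j then 2 ^ Fintype.card ι else 0 := by
  split_ifs with h
  · subst h
    simp [units_cast_mul_self, Finset.card_univ]
  · have h1 : ∑ x : ι → ℤˣ, ((x i : ℤ) : ℝ) * ((x j : ℤ) : ℝ)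
        = -∑ x : ι → ℤˣ, ((x i : ℤ) : ℝ) * ((x j : ℤ) : ℝ) := by
      conv_lhs => rw [← Equiv.sum_comp (flipSign_involutive i).toPerm]
      simp [flipSign, Ne.symm h]
    linarith

lemma sum_norm_sq_rademacher (v : ι → E) :
    ∑ x : ι → ℤˣ, ‖∑ i, ((x i : ℤ) : ℝ) • v i‖ ^ 2 = 2 ^ Fintype.card ι * ∑ i, ‖v i‖ ^ 2 := by
  have h : ∀ x : ι → ℤˣ, ‖∑ i, ((x i : ℤ) : ℝ) • v i‖ ^ 2
      = ∑ i, ∑ j, ((x i : ℤ) : ℝ) * ((x j : ℤ) : ℝ) * inner ℝ (v i) (v j) := by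
    intro x
    rw [← real_inner_self_eq_norm_sq, sum_inner]
    refine Finset.sum_congr rfl fun i _ => ?_
    rw [inner_sum]
    refine Finset.sum_congr rfl fun j _ => ?_
    rw [real_inner_smul_left, real_inner_smul_right]; ring
  simp only [h]
  rw [Finset.sum_comm, Finset.mul_sum]
  refine Finset.sum_congr rfl fun i _ => ?_
  rw [Finset.sum_comm]
  simp only [← Finset.sum_mul, sum_sign_mul_sign]
  simp

/-- The Khintchine inequality between the first and the second moment of a Rademacher sum in a
Hilbert space, with the sharp constant `√2`. -/
theorem khintchine (v : ι → E) :
    √(∑ i, ‖v i‖ ^ 2) * 2 ^ Fintype.card ι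
      ≤ √2 * ∑ x : ι → ℤˣ, ‖∑ i, ((x i : ℤ) : ℝ) • v i‖ := by
  have h := sum_sq_le_of_flipSign (fun x : ι → ℤˣ => ‖∑ i, ((x i : ℤ) : ℝ) • v i‖)
    (fun x => norm_nonneg _) (fun x => by simp) ?_
  · rw [sum_norm_sq_rademacher] at h
    rw [← Real.sqrt_sq (show (0 : ℝ) ≤ 2 ^ Fintype.card ι by positivity),
      ← Real.sqrt_mul (by positivity)]
    conv_rhs => rw [← Real.sqrt_sq (show (0 : ℝ) ≤ ∑ x : ι → ℤˣ, ‖∑ i, ((x i : ℤ) : ℝ) • v i‖ from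
      Finset.sum_nonneg fun x _ => norm_nonneg _), ← Real.sqrt_mul (by norm_num)]
    refine Real.sqrt_le_sqrt ?_
    linarith
  · intro x
    -- The sum over all `i` of the Rademacher sums with the `i`-th sign reversed is `n - 2` times
    -- the original Rademacher sum.
    have h1 : ∀ i, ∑ j, ((flipSign i x j : ℤ) : ℝ) • v j
        = ∑ j, ((x j : ℤ) : ℝ) • v j - (2 * ((x i : ℤ) : ℝ)) • v i := by
      intro i
      have : ∀ j, ((flipSign i x j : ℤ) : ℝ) • v j
          = ((x j : ℤ) : ℝ) • v j - if j = i then (2 * ((x i : ℤ) : ℝ)) • v i else 0 := by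
        intro j
        split_ifs with hj
        · subst hj
          simp only [flipSign, Function.update_self, Units.val_neg, Int.cast_neg]
          rw [← sub_smul]; congr 1; ring
        · simp [flipSign, hj]
      simp [this, Finset.sum_sub_distrib]
    have h2 : ∑ i, ∑ j, ((flipSign i x j : ℤ) : ℝ) • v j
        = ((Fintype.card ι : ℝ) - 2) • ∑ j, ((x j : ℤ) : ℝ) • v j := by
      simp only [h1, Finset.sum_sub_distrib, mul_smul, ← Finset.smul_sum]
      rw [Finset.sum_const, Finset.card_univ, sub_smul, Nat.cast_smul_eq_nsmul]
    calc ((Fintype.card ι : ℝ) - 2) * ‖∑ j, ((x j : ℤ) : ℝ) • v j‖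
        ≤ |(Fintype.card ι : ℝ) - 2| * ‖∑ j, ((x j : ℤ) : ℝ) • v j‖ := by
          gcongr; exact le_abs_self _
      _ = ‖∑ i, ∑ j, ((flipSign i x j : ℤ) : ℝ) • v j‖ := by
          rw [h2, norm_smul, Real.norm_eq_abs]
      _ ≤ _ := norm_sum_le _ _

end Khintchine

/-- The Khintchine inequality for multilinear Rademacher sums, obtained by applying the Hilbert
space version to one group of signs at a time. -/
theorem khintchine_multilinear {ι : Type} [Fintype ι] [DecidableEq ι] (m : ℕ) :
    ∀ {E : Type} [NormedAddCommGroup E] [InnerProductSpace ℝ E] (b : (Fin m → ι) → E),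
    √(∑ i, ‖b i‖ ^ 2) * (2 ^ Fintype.card ι) ^ m
      ≤ √2 ^ m * ∑ x : Fin m → ι → ℤˣ, ‖∑ i, (∏ j, ((x j (i j) : ℤ) : ℝ)) • b i‖ := by
  induction m with
  | zero => intro E _ _ b; simp
  | succ m ih =>
    intro E _ _ b
    let B : (Fin m → ι) → PiLp 2 (fun _ : ι => E) :=
      fun i' => WithLp.toLp 2 fun i₀ => b (Fin.cons i₀ i')
    have hV : ∀ x' : Fin m → ι → ℤˣ,
        ‖∑ i', (∏ j, ((x' j (i' j) : ℤ) : ℝ)) • B i'‖ * 2 ^ Fintype.card ι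
        ≤ √2 * ∑ x₀ : ι → ℤˣ, ‖∑ i : Fin (m + 1) → ι,
            (∏ j, ((Fin.cons (α := fun _ => ι → ℤˣ) x₀ x' j (i j) : ℤ) : ℝ)) • b i‖ := by
      intro x'
      have h := khintchine fun i₀ => ∑ i', (∏ j, ((x' j (i' j) : ℤ) : ℝ)) • b (Fin.cons i₀ i')
      rw [PiLp.norm_eq_of_L2]
      refine le_trans (le_of_eq ?_) (h.trans (le_of_eq ?_))
      · congr 3 with i₀
        congr 2
        simp [B]
      · congr 2 with x₀
        congr 1
        rw [← (Fin.consEquiv fun _ : Fin (m + 1) => ι).sum_comp, Fintype.sum_prod_type]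
        refine Finset.sum_congr rfl fun i₀ _ => ?_
        rw [Finset.smul_sum]
        refine Finset.sum_congr rfl fun i' _ => ?_
        simp [Fin.prod_univ_succ, Fin.consEquiv, mul_smul]
    have hB : ∑ i', ‖B i'‖ ^ 2 = ∑ i, ‖b i‖ ^ 2 := by
      rw [← (Fin.consEquiv fun _ : Fin (m + 1) => ι).sum_comp, Fintype.sum_prod_type,
        Finset.sum_comm]
      refine Finset.sum_congr rfl fun i' _ => ?_
      rw [PiLp.norm_sq_eq_of_L2]
      rfl
    have h := ih B
    rw [hB] at h
    calc √(∑ i, ‖b i‖ ^ 2) * (2 ^ Fintype.card ι) ^ (m + 1)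
        = (√(∑ i, ‖b i‖ ^ 2) * (2 ^ Fintype.card ι) ^ m) * 2 ^ Fintype.card ι := by ring
      _ ≤ (√2 ^ m * ∑ x' : Fin m → ι → ℤˣ, ‖∑ i', (∏ j, ((x' j (i' j) : ℤ) : ℝ)) • B i'‖)
            * 2 ^ Fintype.card ι := by gcongr
      _ = √2 ^ m * ∑ x' : Fin m → ι → ℤˣ,
            (‖∑ i', (∏ j, ((x' j (i' j) : ℤ) : ℝ)) • B i'‖ * 2 ^ Fintype.card ι) := by
          rw [mul_assoc, Finset.sum_mul]
      _ ≤ √2 ^ m * ∑ x' : Fin m → ι → ℤˣ, (√2 * ∑ x₀ : ι → ℤˣ, ‖∑ i : Fin (m + 1) → ι,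
            (∏ j, ((Fin.cons (α := fun _ => ι → ℤˣ) x₀ x' j (i j) : ℤ) : ℝ)) • b i‖) := by
          gcongr _ * ?_
          exact Finset.sum_le_sum fun x' _ => hV x'
      _ = _ := by
          rw [← Finset.mul_sum, ← mul_assoc, ← pow_succ,
            ← (Fin.consEquiv fun _ : Fin (m + 1) => ι → ℤˣ).sum_comp, Fintype.sum_prod_type,
            Finset.sum_comm]
          rfl

/-! ### The Bohnenblust–Hille inequality for multilinear forms -/

section BohnenblustHille

variable {ι : Type} [Fintype ι] {m : ℕ}

/-- A multilinear form that is bounded on sign vectors has bounded mixed `ℓ₁(ℓ₂)` norms: the signs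
in slot `p` realise the `ℓ₁` norm, and the Khintchine inequality in the other slots gives the
`ℓ₂` norms. -/
lemma sum_sqrt_sum_sq_le [DecidableEq ι] (a : (Fin (m + 1) → ι) → ℝ) {M : ℝ}
    (hM : ∀ x : Fin (m + 1) → ι → ℤˣ, |∑ i, a i * ∏ j, ((x j (i j) : ℤ) : ℝ)| ≤ M)
    (p : Fin (m + 1)) :
    ∑ i₀, √(∑ i', a (p.insertNth i₀ i') ^ 2) ≤ √2 ^ m * M := by
  have hN : (0 : ℝ) < (2 ^ Fintype.card ι) ^ m := by positivity
  have h1 : ∀ x' : Fin m → ι → ℤˣ,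
      ∑ i₀, |∑ i', (∏ j, ((x' j (i' j) : ℤ) : ℝ)) * a (p.insertNth i₀ i')| ≤ M := by
    intro x'
    set V : ι → ℝ := fun i₀ => ∑ i', (∏ j, ((x' j (i' j) : ℤ) : ℝ)) * a (p.insertNth i₀ i')
    -- The signs in slot `p` are those of the sums over the other slots.
    let s : ι → ℤˣ := fun i₀ => if 0 ≤ V i₀ then 1 else -1
    have hs : ∀ i₀, |V i₀| = ((s i₀ : ℤ) : ℝ) * V i₀ := by
      intro i₀
      by_cases h : 0 ≤ V i₀
      · simp [s, h, abs_of_nonneg h]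
      · simp [s, h, abs_of_neg (not_le.mp h)]
    calc ∑ i₀, |V i₀| = ∑ i₀, ((s i₀ : ℤ) : ℝ) * V i₀ := Finset.sum_congr rfl fun i₀ _ => hs i₀
      _ = ∑ i, a i * ∏ j, ((p.insertNth (α := fun _ => ι → ℤˣ) s x' j (i j) : ℤ) : ℝ) := by
          rw [← (Fin.insertNthEquiv (fun _ : Fin (m + 1) => ι) p).sum_comp, Fintype.sum_prod_type]
          refine Finset.sum_congr rfl fun i₀ _ => ?_
          rw [Finset.mul_sum]
          refine Finset.sum_congr rfl fun i' _ => ?_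
          rw [Fin.prod_univ_succAbove _ p]
          simp [Fin.insertNthEquiv]
          ring
      _ ≤ M := (le_abs_self _).trans (hM _)
  refine le_of_mul_le_mul_right ?_ hN
  calc (∑ i₀, √(∑ i', a (p.insertNth i₀ i') ^ 2)) * (2 ^ Fintype.card ι) ^ m
      = ∑ i₀, √(∑ i', a (p.insertNth i₀ i') ^ 2) * (2 ^ Fintype.card ι) ^ m := by
        rw [Finset.sum_mul]
    _ ≤ ∑ i₀, √2 ^ m * ∑ x' : Fin m → ι → ℤˣ,
          |∑ i', (∏ j, ((x' j (i' j) : ℤ) : ℝ)) * a (p.insertNth i₀ i')| := by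
        refine Finset.sum_le_sum fun i₀ _ => ?_
        have := khintchine_multilinear m fun i' : Fin m → ι => a (p.insertNth i₀ i')
        simpa [Real.norm_eq_abs] using this
    _ = √2 ^ m * ∑ x' : Fin m → ι → ℤˣ, ∑ i₀,
          |∑ i', (∏ j, ((x' j (i' j) : ℤ) : ℝ)) * a (p.insertNth i₀ i')| := by
        rw [← Finset.mul_sum, Finset.sum_comm]
    _ ≤ √2 ^ m * ∑ x' : Fin m → ι → ℤˣ, M := by
        gcongr with x' _
        exact h1 x'
    _ = √2 ^ m * M * (2 ^ Fintype.card ι) ^ m := by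
        simp; ring

/-- Blei's inequality: mixed `ℓ₁(ℓ₂)` norms bounded by `S` give an `ℓ_p` norm bounded by `S`, with
`p = 2 m / (m + 1)` for `m` slots. With the marginals `w p = A p / S` of a subprobability product
measure `W`, each of the `m` functions `a² / (S² w p)` and `W` has sum at most one, their product is
`(a / S) ^ (2 m)`, and the inequality between the geometric and the arithmetic mean applies. -/
lemma sum_rpow_le_one_of_mixed (a : (Fin (m + 1) → ι) → ℝ) {S : ℝ} (hS : 0 < S)
    (h : ∀ p : Fin (m + 1), ∑ i₀, √(∑ i', a (p.insertNth i₀ i') ^ 2) ≤ S) :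
    ∑ i, (|a i| / S) ^ (2 * ((m : ℝ) + 1) / ((m : ℝ) + 2)) ≤ 1 := by
  set A : Fin (m + 1) → ι → ℝ := fun p i₀ => √(∑ i', a (p.insertNth i₀ i') ^ 2) with hA
  have hA0 : ∀ p i₀, 0 ≤ A p i₀ := fun p i₀ => Real.sqrt_nonneg _
  have hA2 : ∀ p i₀, A p i₀ ^ 2 = ∑ i', a (p.insertNth i₀ i') ^ 2 := fun p i₀ =>
    Real.sq_sqrt (Finset.sum_nonneg fun _ _ => sq_nonneg _)
  have hAa : ∀ p i, a i ≠ 0 → A p (i p) ≠ 0 := by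
    intro p i hai h0
    have h1 := hA2 p (i p)
    rw [h0] at h1
    have h2 := (Finset.sum_eq_zero_iff_of_nonneg fun _ _ => sq_nonneg _).mp
      (h1.symm.trans (by norm_num)) (p.removeNth i) (Finset.mem_univ _)
    rw [Fin.insertNth_self_removeNth] at h2
    exact hai (by simpa using h2)
  set W : (Fin (m + 1) → ι) → ℝ := fun i => ∏ p, A p (i p) / S with hW
  set b : Fin (m + 1) → (Fin (m + 1) → ι) → ℝ := fun p i => a i ^ 2 / (S * A p (i p)) with hb
  have hW0 : ∀ i, 0 ≤ W i := fun i => Finset.prod_nonneg fun p _ => div_nonneg (hA0 _ _) hS.le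
  have hb0 : ∀ p i, 0 ≤ b p i := fun p i =>
    div_nonneg (sq_nonneg _) (mul_nonneg hS.le (hA0 _ _))
  have hAS : ∀ p, ∑ i₀, A p i₀ / S ≤ 1 := by
    intro p
    rw [← Finset.sum_div, div_le_one hS]
    exact h p
  have hWs : ∑ i, W i ≤ 1 := by
    have := Finset.prod_univ_sum (fun _ : Fin (m + 1) => (Finset.univ : Finset ι))
      (fun p i₀ => A p i₀ / S)
    rw [Fintype.piFinset_univ] at this
    rw [← this]
    exact Finset.prod_le_one (fun p _ => Finset.sum_nonneg fun i₀ _ => div_nonneg (hA0 _ _) hS.le)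
      fun p _ => hAS p
  have hbs : ∀ p, ∑ i, b p i ≤ 1 := by
    intro p
    refine le_trans (le_of_eq ?_) (hAS p)
    rw [← (Fin.insertNthEquiv (fun _ : Fin (m + 1) => ι) p).sum_comp, Fintype.sum_prod_type]
    refine Finset.sum_congr rfl fun i₀ _ => ?_
    simp only [hb, Fin.insertNthEquiv, Equiv.coe_fn_mk, Fin.insertNth_apply_same]
    rw [← Finset.sum_div, ← hA2]
    by_cases h0 : A p i₀ = 0
    · simp [h0]
    · field_simp
  have hmain : ∀ i, (|a i| / S) ^ (2 * ((m : ℝ) + 1) / ((m : ℝ) + 2))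
      ≤ (W i + ∑ p, b p i) / ((m : ℝ) + 2) := by
    intro i
    have hnn : 0 ≤ (W i + ∑ p, b p i) / ((m : ℝ) + 2) :=
      div_nonneg (add_nonneg (hW0 i) (Finset.sum_nonneg fun p _ => hb0 p i)) (by positivity)
    by_cases hai : a i = 0
    · rw [hai, abs_zero, zero_div, Real.zero_rpow (by positivity)]
      exact hnn
    let z : Fin (m + 2) → ℝ := Fin.cons (W i) fun p => b p i
    have hz0 : ∀ j, 0 ≤ z j := by
      intro j
      refine Fin.cases (hW0 i) (fun p => hb0 p i) j
    have hamgm := Real.geom_mean_le_arith_mean_weighted Finset.univ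
      (fun _ : Fin (m + 2) => 1 / ((m : ℝ) + 2)) z (fun _ _ => by positivity)
      (by simp; field_simp) fun j _ => hz0 j
    have hprod : ∏ j, z j = (|a i| / S) ^ (2 * (m + 1)) := by
      rw [Fin.prod_univ_succ]
      simp only [z, Fin.cons_zero, Fin.cons_succ, hW, ← Finset.prod_mul_distrib]
      have : ∀ p ∈ (Finset.univ : Finset (Fin (m + 1))),
          A p (i p) / S * b p i = (|a i| / S) ^ 2 := by
        intro p _
        have h0 := hAa p i hai
        rw [div_pow, sq_abs, hb]
        field_simp
      rw [Finset.prod_congr rfl this, Finset.prod_const, Finset.card_univ, Fintype.card_fin,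
        ← pow_mul]
    rw [Real.finsetProd_rpow _ _ fun j _ => hz0 j, hprod, ← Finset.mul_sum,
      Fin.sum_univ_succ] at hamgm
    simp only [z, Fin.cons_zero, Fin.cons_succ] at hamgm
    refine le_trans (le_of_eq ?_) (hamgm.trans (le_of_eq (by ring)))
    rw [← Real.rpow_natCast, ← Real.rpow_mul (by positivity)]
    congr 1
    push_cast
    ring
  calc _ ≤ ∑ i, (W i + ∑ p, b p i) / ((m : ℝ) + 2) := Finset.sum_le_sum fun i _ => hmain i
    _ = (∑ i, W i + ∑ p, ∑ i, b p i) / ((m : ℝ) + 2) := by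
        rw [← Finset.sum_div, Finset.sum_add_distrib, Finset.sum_comm]
    _ ≤ (1 + ∑ p : Fin (m + 1), 1) / ((m : ℝ) + 2) := by
        gcongr with p _
        exact hbs p
    _ = 1 := by
        simp; field_simp; ring

/-- The multilinear Bohnenblust–Hille inequality, for every exponent that is at least the critical
one. -/
theorem bohnenblustHille_multilinear [DecidableEq ι] (a : (Fin (m + 1) → ι) → ℝ) {M : ℝ} (hM0 : 0 < M)
    (hM : ∀ x : Fin (m + 1) → ι → ℤˣ, |∑ i, a i * ∏ j, ((x j (i j) : ℤ) : ℝ)| ≤ M)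
    {r : ℝ} (hr : 2 * ((m : ℝ) + 1) / ((m : ℝ) + 2) ≤ r) :
    ∑ i, |a i| ^ r ≤ (√2 ^ m * M) ^ r := by
  set S := √2 ^ m * M with hS
  have hS0 : 0 < S := by positivity
  have hr0 : (0 : ℝ) < 2 * ((m : ℝ) + 1) / ((m : ℝ) + 2) := by positivity
  have h1 := sum_rpow_le_one_of_mixed a hS0 (sum_sqrt_sum_sq_le a hM)
  have h2 : ∀ i, (|a i| / S) ^ r ≤ (|a i| / S) ^ (2 * ((m : ℝ) + 1) / ((m : ℝ) + 2)) := by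
    intro i
    have h0 : 0 ≤ |a i| / S := by positivity
    have hle : |a i| / S ≤ 1 := by
      by_contra hc
      push Not at hc
      have := Finset.single_le_sum
        (f := fun i => (|a i| / S) ^ (2 * ((m : ℝ) + 1) / ((m : ℝ) + 2)))
        (fun i _ => by positivity) (Finset.mem_univ i)
      have := Real.one_lt_rpow hc hr0
      linarith
    exact Real.rpow_le_rpow_of_exponent_ge_of_imp h0 hle hr
      (fun _ h => absurd h (hr0.trans_le hr).ne')
  have h3 : ∑ i, (|a i| / S) ^ r ≤ 1 := (Finset.sum_le_sum fun i _ => h2 i).trans h1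
  simp only [Real.div_rpow (abs_nonneg _) hS0.le, ← Finset.sum_div] at h3
  rwa [div_le_one (by positivity)] at h3

end BohnenblustHille

/-! ### Coefficients of polynomials bounded on an interval -/

lemma prod_erase_abs_sub (i k : ℕ) (hik : i ≤ k) :
    ∏ j ∈ (Finset.range (k + 1)).erase i, |(i : ℝ) - j| = i.factorial * (k - i).factorial := by
  induction k, hik using Nat.le_induction with
  | base =>
    have h : (Finset.range (i + 1)).erase i = Finset.range i := by ext; simp; omega
    rw [h, ← Finset.prod_range_reflect, ← Finset.prod_range_add_one_eq_factorial]
    push_cast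
    simp only [Nat.sub_self, Nat.factorial_zero, Nat.cast_one, mul_one]
    refine Finset.prod_congr rfl fun j hj => ?_
    have hj := Finset.mem_range.mp hj
    rw [Nat.sub_sub, Nat.cast_sub (by omega)]
    push_cast
    rw [abs_of_nonneg] <;> linarith
  | succ k hk ih =>
    have h : (Finset.range (k + 1 + 1)).erase i = insert (k + 1) ((Finset.range (k + 1)).erase i) := by
      ext; simp; omega
    rw [h, Finset.prod_insert (by simp), ih, Nat.succ_sub hk, Nat.factorial_succ]
    have h1 : |(i : ℝ) - ((k + 1 : ℕ) : ℝ)| = ((k - i + 1 : ℕ) : ℝ) := by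
      have : (i : ℝ) ≤ k := by exact_mod_cast hk
      push_cast [Nat.cast_sub hk]
      rw [abs_of_nonpos] <;> linarith
    rw [h1]
    push_cast
    ring

/-- Each coefficient of a polynomial of degree at most `k` is bounded in terms of its maximum on
`[-1, 1]`: this is Lagrange interpolation at `k + 1` equidistant nodes. -/
lemma abs_coeff_le_of_abs_eval_le {k m : ℕ} (hk : 1 ≤ k) (hm : m ≤ k) {p : Polynomial ℝ}
    (hp : p.natDegree ≤ k) {M : ℝ} (hM : ∀ t : ℝ, |t| ≤ 1 → |p.eval t| ≤ M) :
    |p.coeff m| ≤ 2 ^ k * k ^ k / k.factorial * M := by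
  have hk0 : (0 : ℝ) < k := by exact_mod_cast hk
  have hM0 : 0 ≤ M := (abs_nonneg _).trans (hM 0 (by simp))
  let v : ℕ → ℝ := fun i => 2 * i / k - 1
  have hv : ∀ i ∈ Finset.range (k + 1), |v i| ≤ 1 := by
    intro i hi
    have : (i : ℝ) ≤ k := by exact_mod_cast Nat.lt_succ_iff.mp (Finset.mem_range.mp hi)
    have h2 : (i : ℝ) / k ≤ 1 := (div_le_one hk0).mpr this
    have h3 : 0 ≤ (i : ℝ) / k := by positivity
    have h4 : v i = 2 * ((i : ℝ) / k) - 1 := by simp only [v]; ring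
    rw [h4, abs_le]
    constructor <;> linarith
  have hvsub : ∀ i j, v i - v j = 2 / k * ((i : ℝ) - j) := by
    intro i j; simp only [v]; ring
  have hinj : Set.InjOn v (Finset.range (k + 1)) := by
    intro i _ j _ hij
    have h1 := hvsub i j
    rw [hij, sub_self, eq_comm, mul_eq_zero] at h1
    rcases h1 with h1 | h1
    · exact absurd h1 (by positivity)
    · exact_mod_cast sub_eq_zero.mp h1
  have hdeg : p.degree < (Finset.range (k + 1)).card := by
    rw [Finset.card_range]
    exact lt_of_le_of_lt Polynomial.degree_le_natDegree (by exact_mod_cast Nat.lt_succ_of_le hp)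
  have h0 := Lagrange.eval_iterate_derivative_eq_sum hinj hdeg (k := m)
    (by rw [Finset.card_range]; omega) (x := 0)
  have hc : p.coeff m * m.factorial = (Polynomial.derivative^[m] p).eval 0 := by
    rw [← Polynomial.coeff_zero_eq_eval_zero, Polynomial.coeff_iterate_derivative]
    simp [Nat.descFactorial_self, mul_comm]
  rw [← hc, mul_comm] at h0
  have hmf : (m.factorial : ℝ) ≠ 0 := by positivity
  rw [mul_left_cancel₀ hmf h0]
  have hterm : ∀ i ∈ Finset.range (k + 1),
      |(p.eval (v i) / ∏ j ∈ (Finset.range (k + 1)).erase i, (v i - v j)) *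
        ∑ t ∈ ((Finset.range (k + 1)).erase i).powersetCard ((Finset.range (k + 1)).card - (m + 1)),
          ∏ a ∈ t, (0 - v a)| ≤ M * (k / 2) ^ k * 2 ^ k / k.factorial * (k.choose i : ℝ) := by
    intro i hi
    have hik : i ≤ k := Nat.lt_succ_iff.mp (Finset.mem_range.mp hi)
    have hcard : ((Finset.range (k + 1)).erase i).card = k := by
      rw [Finset.card_erase_of_mem hi, Finset.card_range]; rfl
    have e1 : |∏ j ∈ (Finset.range (k + 1)).erase i, (v i - v j)|
        = (2 / k) ^ k * (i.factorial * (k - i).factorial) := by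
      rw [Finset.abs_prod]
      simp only [hvsub, abs_mul, Finset.prod_mul_distrib, Finset.prod_const, hcard,
        prod_erase_abs_sub i k hik]
      rw [abs_of_pos (by positivity)]
    have e2 : |∑ t ∈ ((Finset.range (k + 1)).erase i).powersetCard
          ((Finset.range (k + 1)).card - (m + 1)), ∏ a ∈ t, (0 - v a)| ≤ 2 ^ k := by
      refine (Finset.abs_sum_le_sum_abs _ _).trans ?_
      refine (Finset.sum_le_card_nsmul _ _ 1 ?_).trans ?_
      · intro t ht
        rw [Finset.abs_prod]
        refine Finset.prod_le_one (fun _ _ => abs_nonneg _) fun a ha => ?_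
        have := (Finset.mem_powersetCard.mp ht).1 ha
        rw [zero_sub, abs_neg]
        exact hv a (Finset.mem_of_mem_erase this)
      · rw [Finset.card_powersetCard, hcard, nsmul_eq_mul, mul_one]
        exact_mod_cast Nat.choose_le_two_pow _ _
    rw [abs_mul, abs_div, e1]
    have hch : (k.choose i : ℝ) = k.factorial / (i.factorial * (k - i).factorial) :=
      Nat.cast_choose ℝ hik
    calc _ ≤ M / ((2 / k) ^ k * (i.factorial * (k - i).factorial)) * 2 ^ k := by
          gcongr
          exact hM _ (hv i hi)
      _ = _ := by
          rw [hch, div_pow, div_pow]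
          field_simp
  calc _ ≤ ∑ i ∈ Finset.range (k + 1), M * (k / 2) ^ k * 2 ^ k / k.factorial * (k.choose i : ℝ) :=
        (Finset.abs_sum_le_sum_abs _ _).trans (Finset.sum_le_sum hterm)
    _ = _ := by
        rw [← Finset.mul_sum]
        have : ∑ i ∈ Finset.range (k + 1), (k.choose i : ℝ) = 2 ^ k := by
          exact_mod_cast Nat.sum_range_choose k
        rw [this, div_pow]
        field_simp

/-! ### Product states -/

/-- The expectation of the Pauli matrix `σ` in the qubit state whose Bloch vector is
`t / √3` times the sign vector `y`. -/
noncomputable def blochFactor (t : ℝ) (y : Pauli → ℤˣ) (σ : Pauli) : ℝ :=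
  if σ = Pauli.I then 1 else t * ((y σ : ℤ) : ℝ) / √3

/-- Every sign vector, scaled to unit length, is the Bloch vector of a pure state. -/
lemma exists_pure_state (y : Pauli → ℤˣ) :
    ∃ ψ : Fin 2 → ℂ, ∑ a, ‖ψ a‖ ^ 2 = 1 ∧
      ∀ σ : Pauli, ∑ a, ∑ b, star (ψ a) * (σ.toMatrix a b * ψ b) = (blochFactor 1 y σ : ℂ) := by
  have hu : ∀ σ, (((y σ : ℤ) : ℝ) / √3) ^ 2 = 1 / 3 := by
    intro σ
    rw [div_pow, Real.sq_sqrt (by norm_num)]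
    rcases Int.units_eq_one_or (y σ) with h | h <;> simp [h]
  obtain ⟨u, v, w, hu', hv', hw'⟩ : ∃ u v w : ℝ, u = ((y .X : ℤ) : ℝ) / √3 ∧
      v = ((y .Y : ℤ) : ℝ) / √3 ∧ w = ((y .Z : ℤ) : ℝ) / √3 := ⟨_, _, _, rfl, rfl, rfl⟩
  have hX : blochFactor 1 y .X = u := by simp [blochFactor, hu']
  have hY : blochFactor 1 y .Y = v := by simp [blochFactor, hv']
  have hZ : blochFactor 1 y .Z = w := by simp [blochFactor, hw']
  have hu2 : u ^ 2 = 1 / 3 := by rw [hu', hu]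
  have hv2 : v ^ 2 = 1 / 3 := by rw [hv', hu]
  have hw2 : w ^ 2 = 1 / 3 := by rw [hw', hu]
  have hw : 0 < 1 + w := by nlinarith
  set c := √(2 * (1 + w)) with hc
  have hc2 : c ^ 2 = 2 * (1 + w) := Real.sq_sqrt (by positivity)
  have hc0 : c ≠ 0 := (Real.sqrt_pos.mpr (by positivity)).ne'
  -- The ray of `(1 + w, u + v i)` has Bloch vector `(u, v, w)`, and `c` is its length.
  refine ⟨![(((1 + w) / c : ℝ) : ℂ), ⟨u / c, v / c⟩], ?_, ?_⟩
  · simp only [Fin.sum_univ_two, Matrix.cons_val_zero, Matrix.cons_val_one, Complex.sq_norm,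
      Complex.normSq_mk, Complex.normSq_ofReal]
    field_simp
    rw [hc2]
    linarith
  · intro σ
    simp only [Fin.sum_univ_two]
    cases σ
    · apply Complex.ext <;> simp [Pauli.toMatrix, blochFactor] <;> field_simp <;> nlinarith
    · rw [hX]
      apply Complex.ext <;> simp [Pauli.toMatrix] <;> field_simp <;> (try rw [hc2]) <;> ring
    · rw [hY]
      apply Complex.ext <;> simp [Pauli.toMatrix] <;> field_simp <;> (try rw [hc2]) <;> ring
    · rw [hZ]
      apply Complex.ext <;> simp [Pauli.toMatrix] <;> field_simp <;> nlinarith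

lemma norm_sum_star_mul_le {n : ℕ} (H : QubitOp n) (ψ : (Fin n → Fin 2) → ℂ)
    (hψ : ∑ a, ‖ψ a‖ ^ 2 = 1) :
    ‖∑ a, ∑ b, star (ψ a) * (H a b * ψ b)‖ ≤ spectralNormOp H := by
  set Ψ : EuclideanSpace ℂ (Fin n → Fin 2) := WithLp.toLp 2 ψ with hΨ
  have hn : ‖Ψ‖ = 1 := by
    rw [EuclideanSpace.norm_eq, hΨ]
    simp [hψ]
  have h1 : ∑ a, ∑ b, star (ψ a) * (H a b * ψ b)
      = inner ℂ Ψ (Matrix.toEuclideanCLM (n := Fin n → Fin 2) (𝕜 := ℂ) H Ψ) := by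
    rw [PiLp.inner_apply]
    refine Finset.sum_congr rfl fun a _ => ?_
    rw [← Finset.mul_sum, hΨ, Matrix.toEuclideanCLM_toLp]
    simp [Matrix.mulVec, dotProduct, mul_comm]
  rw [h1]
  calc _ ≤ ‖Ψ‖ * ‖Matrix.toEuclideanCLM (n := Fin n → Fin 2) (𝕜 := ℂ) H Ψ‖ :=
        norm_inner_le_norm _ _
    _ ≤ ‖Ψ‖ * (spectralNormOp H * ‖Ψ‖) := by
        gcongr
        exact ContinuousLinearMap.le_opNorm _ _
    _ = spectralNormOp H := by rw [hn]; ring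

/-- The expectation of an operator in a pure product state. -/
lemma norm_sum_pauliCoeff_mul_pure_le {n : ℕ} (H : QubitOp n) (y : Fin n → Pauli → ℤˣ) :
    ‖∑ P : PauliString n, pauliCoeff H P * ∏ q, (blochFactor 1 (y q) (P q) : ℂ)‖
      ≤ spectralNormOp H := by
  choose ψ hψ1 hψ using fun q => exists_pure_state (y q)
  have hnorm : ∑ a : Fin n → Fin 2, ‖∏ q, ψ q (a q)‖ ^ 2 = 1 := by
    have := Finset.prod_univ_sum (fun _ : Fin n => (Finset.univ : Finset (Fin 2)))
      (fun q a => ‖ψ q a‖ ^ 2)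
    rw [Fintype.piFinset_univ] at this
    simp only [norm_prod, ← Finset.prod_pow]
    rw [← this]
    exact Finset.prod_eq_one fun q _ => hψ1 q
  refine le_trans (le_of_eq ?_) (norm_sum_star_mul_le H (fun a => ∏ q, ψ q (a q)) hnorm)
  congr 1
  have hP : ∀ P : PauliString n, ∏ q, (blochFactor 1 (y q) (P q) : ℂ)
      = ∑ a : Fin n → Fin 2, ∑ b : Fin n → Fin 2,
        star (∏ q, ψ q (a q)) * (P.toMatrix a b * ∏ q, ψ q (b q)) := by
    intro P
    simp only [← hψ, Finset.prod_univ_sum, Fintype.piFinset_univ, PauliString.toMatrix,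
      Matrix.of_apply, star_prod, Finset.prod_mul_distrib]
  simp only [hP]
  conv_rhs => rw [← sum_pauliCoeff H]
  simp only [Matrix.sum_apply, Matrix.smul_apply, smul_eq_mul, Finset.sum_mul, Finset.mul_sum]
  rw [Finset.sum_comm]
  refine Finset.sum_congr rfl fun a _ => ?_
  rw [Finset.sum_comm]
  refine Finset.sum_congr rfl fun b _ => Finset.sum_congr rfl fun P _ => ?_
  ring

/-- A Bloch vector of length `|t| ≤ 1` is a convex combination of two opposite unit vectors. -/
lemma blochFactor_eq_sum (t : ℝ) (y : Pauli → ℤˣ) (σ : Pauli) :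
    blochFactor t y σ
      = ∑ u : ℤˣ, (1 + t * ((u : ℤ) : ℝ)) / 2 * blochFactor 1 (fun τ => u * y τ) σ := by
  have h : (Finset.univ : Finset ℤˣ) = {1, -1} := rfl
  rw [h, Finset.sum_pair (by decide)]
  unfold blochFactor
  split_ifs
  · simp; ring
  · simp; ring

/-- The expectation of an operator in a product of mixed states. -/
lemma norm_sum_pauliCoeff_mul_le {n : ℕ} (H : QubitOp n) {t : ℝ} (ht : |t| ≤ 1)
    (y : Fin n → Pauli → ℤˣ) :
    ‖∑ P : PauliString n, pauliCoeff H P * ∏ q, (blochFactor t (y q) (P q) : ℂ)‖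
      ≤ spectralNormOp H := by
  set lam : ℤˣ → ℝ := fun u => (1 + t * ((u : ℤ) : ℝ)) / 2 with hlam
  have hlam0 : ∀ u, 0 ≤ lam u := by
    intro u
    have := abs_le.mp ht
    rcases Int.units_eq_one_or u with h | h <;> simp [hlam, h] <;> linarith
  have hlam1 : ∑ u, lam u = 1 := by
    have h : (Finset.univ : Finset ℤˣ) = {1, -1} := rfl
    rw [h, Finset.sum_pair (by decide)]
    simp [hlam]; ring
  have hsum : ∑ u : Fin n → ℤˣ, ∏ q, lam (u q) = 1 := by
    have := Finset.prod_univ_sum (fun _ : Fin n => (Finset.univ : Finset ℤˣ)) (fun _ u => lam u)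
    rw [Fintype.piFinset_univ] at this
    rw [← this]
    simp only [hlam1, Finset.prod_const_one]
  have hexp : ∀ P : PauliString n, ∏ q, (blochFactor t (y q) (P q) : ℂ)
      = ∑ u : Fin n → ℤˣ, ((∏ q, lam (u q) : ℝ) : ℂ)
        * ∏ q, (blochFactor 1 (fun τ => u q * y q τ) (P q) : ℂ) := by
    intro P
    have : ∀ q, (blochFactor t (y q) (P q) : ℂ)
        = ∑ u : ℤˣ, (lam u : ℂ) * (blochFactor 1 (fun τ => u * y q τ) (P q) : ℂ) := by
      intro q
      rw [blochFactor_eq_sum]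
      push_cast [hlam]
      rfl
    simp only [this, Finset.prod_univ_sum, Fintype.piFinset_univ, Finset.prod_mul_distrib,
      Complex.ofReal_prod]
  calc ‖∑ P : PauliString n, pauliCoeff H P * ∏ q, (blochFactor t (y q) (P q) : ℂ)‖
      = ‖∑ u : Fin n → ℤˣ, ((∏ q, lam (u q) : ℝ) : ℂ) * ∑ P : PauliString n,
          pauliCoeff H P * ∏ q, (blochFactor 1 (fun τ => u q * y q τ) (P q) : ℂ)‖ := by
        congr 1
        simp only [hexp, Finset.mul_sum]
        rw [Finset.sum_comm]
        exact Finset.sum_congr rfl fun u _ => Finset.sum_congr rfl fun P _ => by ring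
    _ ≤ ∑ u : Fin n → ℤˣ, (∏ q, lam (u q)) * spectralNormOp H := by
        refine (norm_sum_le _ _).trans (Finset.sum_le_sum fun u _ => ?_)
        have h0 : 0 ≤ ∏ q, lam (u q) := Finset.prod_nonneg fun q _ => hlam0 _
        rw [norm_mul, Complex.norm_of_nonneg h0]
        exact mul_le_mul_of_nonneg_left (norm_sum_pauliCoeff_mul_pure_le H _) h0
    _ = spectralNormOp H := by rw [← Finset.sum_mul, hsum, one_mul]

lemma Pauli.isHermitian_toMatrix (σ : Pauli) (a b : Fin 2) :
    star (σ.toMatrix b a) = σ.toMatrix a b := by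
  cases σ <;> fin_cases a <;> fin_cases b <;> simp [Pauli.toMatrix]

/-- The Pauli coefficients of a Hermitian operator are real. -/
lemma pauliCoeff_eq_re {n : ℕ} {H : QubitOp n} (hH : H.IsHermitian) (P : PauliString n) :
    pauliCoeff H P = ((pauliCoeff H P).re : ℂ) := by
  have hP : P.toMatrix.IsHermitian := by
    ext a b
    simp only [Matrix.conjTranspose_apply, PauliString.toMatrix, Matrix.of_apply, star_prod,
      Pauli.isHermitian_toMatrix]
  have h : star (P.toMatrix * H).trace = (P.toMatrix * H).trace := by
    rw [← Matrix.trace_conjTranspose, Matrix.conjTranspose_mul, hP.eq, hH.eq, Matrix.trace_mul_comm]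
  symm
  rw [← Complex.conj_eq_iff_re, pauliCoeff, map_div₀]
  congr 1
  · rw [map_pow, map_ofNat]

lemma pauliCoeff_eq_zero_of_lt_weight {n k : ℕ} {H : QubitOp n} (hH : IsLocalHamiltonian k H)
    {P : PauliString n} (hP : k < P.weight) : pauliCoeff H P = 0 := by
  obtain ⟨-, α, rfl⟩ := hH
  rw [Finset.sum_filter]
  have : ∀ Q : PauliString n, (if Q.weight ≤ k then α Q • Q.toMatrix else 0)
      = (if Q.weight ≤ k then α Q else 0) • Q.toMatrix := by
    intro Q; split_ifs <;> simp
  simp only [this, pauliCoeff_sum]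
  simp [hP]

/-! ### Decoupling the Pauli polynomial -/

/-- The set of qubits on which `P` acts nontrivially. -/
def PauliString.support {n : ℕ} (P : PauliString n) : Finset (Fin n) :=
  Finset.univ.filter fun q => P q ≠ Pauli.I

namespace PauliString

variable {n : ℕ}

lemma mem_support {P : PauliString n} {q : Fin n} : q ∈ P.support ↔ P q ≠ Pauli.I := by
  simp [support]

lemma card_support (P : PauliString n) : P.support.card = P.weight := rfl

lemma prod_blochFactor (P : PauliString n) (t : ℝ) (y : Fin n → Pauli → ℤˣ) :
    ∏ q, blochFactor t (y q) (P q)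
      = t ^ P.weight * ((√3)⁻¹ ^ P.weight * ∏ q ∈ P.support, ((y q (P q) : ℤ) : ℝ)) := by
  have h : ∀ q, blochFactor t (y q) (P q)
      = if P q ≠ Pauli.I then t * (√3)⁻¹ * ((y q (P q) : ℤ) : ℝ) else 1 := by
    intro q
    unfold blochFactor
    by_cases hq : P q = Pauli.I
    · simp [hq]
    · simp [hq]; ring
  simp only [h]
  rw [Finset.prod_ite, Finset.prod_const_one, mul_one, Finset.prod_mul_distrib,
    Finset.prod_const, mul_pow, mul_assoc]
  rfl

/-- The strings of weight `m` whose support the colouring `c` maps bijectively onto the `m`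
colours. -/
def rainbow {m : ℕ} (c : Fin n → Fin m) : Finset (PauliString n) :=
  Finset.univ.filter fun P => P.weight = m ∧ P.support.image c = Finset.univ

/-- The Pauli string with letter `(i j).2` at the qubit `(i j).1`, where `j` is the colour of this
qubit, and the identity at all other qubits. -/
def ofColoured {m : ℕ} (c : Fin n → Fin m) (i : Fin m → Fin n × Pauli) : PauliString n :=
  fun q => if (i (c q)).1 = q then (i (c q)).2 else Pauli.I

/-- A choice of one qubit of each colour together with a nontrivial letter for it. -/
def IsColoured {m : ℕ} (c : Fin n → Fin m) (i : Fin m → Fin n × Pauli) : Prop :=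
  ∀ j, c (i j).1 = j ∧ (i j).2 ≠ Pauli.I

instance {m : ℕ} (c : Fin n → Fin m) : DecidablePred (IsColoured c) :=
  fun _ => inferInstanceAs (Decidable (∀ _, _))

variable {m : ℕ} {c : Fin n → Fin m}

lemma IsColoured.ofColoured_apply {i : Fin m → Fin n × Pauli} (hi : IsColoured c i) (j : Fin m) :
    ofColoured c i (i j).1 = (i j).2 := by
  simp [ofColoured, (hi j).1]

lemma IsColoured.injective_fst {i : Fin m → Fin n × Pauli} (hi : IsColoured c i) :
    Function.Injective fun j => (i j).1 := by
  intro j j' h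
  rw [← (hi j).1, ← (hi j').1]
  exact congrArg c h

lemma IsColoured.support_ofColoured {i : Fin m → Fin n × Pauli} (hi : IsColoured c i) :
    (ofColoured c i).support = Finset.univ.image fun j => (i j).1 := by
  ext q
  simp only [mem_support, Finset.mem_image, Finset.mem_univ, true_and]
  constructor
  · intro h
    refine ⟨c q, ?_⟩
    by_contra hq
    exact h (by simp [ofColoured, hq])
  · rintro ⟨j, rfl⟩
    rw [hi.ofColoured_apply]
    exact (hi j).2

/-- Rainbow strings correspond to choices of one qubit and one nontrivial letter for each
colour. -/
lemma sum_rainbow (c : Fin n → Fin m) (f : PauliString n → ℝ) :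
    ∑ P ∈ rainbow c, f P
      = ∑ i : Fin m → Fin n × Pauli, if IsColoured c i then f (ofColoured c i) else 0 := by
  rw [← Finset.sum_filter]
  symm
  refine Finset.sum_bij (fun i _ => ofColoured c i) ?_ ?_ ?_ fun _ _ => rfl
  · intro i hi
    have hi : IsColoured c i := (Finset.mem_filter.mp hi).2
    refine Finset.mem_filter.mpr ⟨Finset.mem_univ _, ?_, ?_⟩
    · rw [← card_support, hi.support_ofColoured, Finset.card_image_of_injective _ hi.injective_fst,
        Finset.card_univ, Fintype.card_fin]
    · rw [hi.support_ofColoured, Finset.image_image]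
      refine Finset.eq_univ_of_forall fun j => Finset.mem_image.mpr ⟨j, Finset.mem_univ _, ?_⟩
      exact (hi j).1
  · intro i hi i' hi' h
    have hi : IsColoured c i := (Finset.mem_filter.mp hi).2
    have hi' : IsColoured c i' := (Finset.mem_filter.mp hi').2
    funext j
    have h1 : ofColoured c i' (i j).1 = (i j).2 := by rw [← hi.ofColoured_apply j, h]
    have h2 : (i' j).1 = (i j).1 := by
      by_contra hne
      apply (hi j).2
      rw [← h1]
      simp [ofColoured, (hi j).1, hne]
    refine Prod.ext h2.symm ?_
    rw [← h1, ← h2, hi'.ofColoured_apply]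
  · intro P hP
    obtain ⟨-, hw, himg⟩ := Finset.mem_filter.mp hP
    have hex : ∀ j, ∃ q ∈ P.support, c q = j := fun j =>
      Finset.mem_image.mp (himg ▸ Finset.mem_univ j)
    choose g hg hgc using hex
    have hcard : (P.support.image c).card = P.support.card := by
      rw [himg, Finset.card_univ, Fintype.card_fin, card_support, hw]
    have hinj := Finset.card_image_iff.mp hcard
    refine ⟨fun j => (g j, P (g j)), Finset.mem_filter.mpr ⟨Finset.mem_univ _, fun j =>
      ⟨hgc j, mem_support.mp (hg j)⟩⟩, ?_⟩
    funext q
    simp only [ofColoured]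
    split_ifs with hq
    · rw [hq]
    · by_contra hI
      exact hq (hinj (hg _) (mem_support.mpr (Ne.symm hI)) (hgc _))

/-- At least `m! m ^ (n - m)` colourings are bijective on a given set of `m` qubits: the bijections
of this set onto the colours, extended arbitrarily. -/
lemma le_card_rainbow_colourings {s : Finset (Fin n)} (hs : s.card = m) :
    m.factorial * m ^ (n - m)
      ≤ (Finset.univ.filter fun c : Fin n → Fin m => s.image c = Finset.univ).card := by
  have h1 : Fintype.card ((s ≃ Fin m) × ({q // q ∉ s} → Fin m)) = m.factorial * m ^ (n - m) := by
    have e : s ≃ Fin m := Fintype.equivFinOfCardEq (by simp [hs])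
    rw [Fintype.card_prod, Fintype.card_equiv e, Fintype.card_fun, Fintype.card_fin]
    congr 1
    · simp [hs]
    · congr 1
      rw [Fintype.card_subtype_compl]
      simp [hs]
  rw [← h1, ← Finset.card_univ]
  refine Finset.card_le_card_of_injOn
    (fun eg q => if h : q ∈ s then eg.1 ⟨q, h⟩ else eg.2 ⟨q, h⟩) ?_ ?_
  · intro eg _
    simp only [Finset.coe_filter, Finset.mem_univ, true_and, Set.mem_ofPred_eq]
    refine Finset.eq_univ_of_forall fun j => Finset.mem_image.mpr ⟨(eg.1.symm j).1,
      (eg.1.symm j).2, ?_⟩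
    simp
  · rintro ⟨e, g⟩ _ ⟨e', g'⟩ _ h
    refine Prod.ext ?_ ?_
    · ext q
      have := congrFun h q.1
      simpa using congrArg Fin.val this
    · funext q
      have := congrFun h q.1
      simpa [q.2] using this

end PauliString

/-- Averaging over the signs of the colours against their product selects the rainbow sets. -/
lemma sum_prod_sign_mul {n m : ℕ} (c : Fin n → Fin m) {s : Finset (Fin n)} (hs : s.card = m) :
    ∑ e : Fin m → ℤˣ, (∏ j, ((e j : ℤ) : ℝ)) * ∏ q ∈ s, ((e (c q) : ℤ) : ℝ)
      = if s.image c = Finset.univ then 2 ^ m else 0 := by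
  split_ifs with h
  · have hcard : (s.image c).card = s.card := by
      rw [h, Finset.card_univ, Fintype.card_fin, hs]
    have hinj := Finset.card_image_iff.mp hcard
    have h1 : ∀ e : Fin m → ℤˣ, ∏ q ∈ s, ((e (c q) : ℤ) : ℝ) = ∏ j, ((e j : ℤ) : ℝ) := by
      intro e
      rw [← h, Finset.prod_image hinj]
    simp only [h1, ← Finset.prod_mul_distrib, units_cast_mul_self]
    simp [Finset.card_univ]
  · obtain ⟨j, hj⟩ : ∃ j, j ∉ s.image c := by
      by_contra hc
      push Not at hc
      exact h (Finset.eq_univ_of_forall hc)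
    have h2 : ∀ e : Fin m → ℤˣ, ∏ q ∈ s, ((flipSign j e (c q) : ℤ) : ℝ)
        = ∏ q ∈ s, ((e (c q) : ℤ) : ℝ) := by
      intro e
      refine Finset.prod_congr rfl fun q hq => ?_
      have : c q ≠ j := fun hcq => hj (Finset.mem_image.mpr ⟨q, hq, hcq⟩)
      simp [flipSign, this]
    have h3 : ∀ e : Fin m → ℤˣ, ∏ i, ((flipSign j e i : ℤ) : ℝ) = -∏ i, ((e i : ℤ) : ℝ) := by
      intro e
      have := walsh_flipSign j Finset.univ e
      simpa [walsh] using this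
    have h4 : ∑ e : Fin m → ℤˣ, (∏ j, ((e j : ℤ) : ℝ)) * ∏ q ∈ s, ((e (c q) : ℤ) : ℝ)
        = -∑ e : Fin m → ℤˣ, (∏ j, ((e j : ℤ) : ℝ)) * ∏ q ∈ s, ((e (c q) : ℤ) : ℝ) := by
      conv_lhs => rw [← Equiv.sum_comp (flipSign_involutive j).toPerm]
      simp [h2, h3]
    linarith

section Decoupling

variable {n k : ℕ} {α : PauliString n → ℝ} {M : ℝ}

/-- The homogeneous parts of the polynomial in the Bloch vectors are bounded on sign vectors. -/
lemma abs_sum_weight_eq_le (hk : 1 ≤ k) (hα : ∀ P, k < P.weight → α P = 0)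
    (hM : ∀ t : ℝ, |t| ≤ 1 → ∀ y : Fin n → Pauli → ℤˣ,
      |∑ P, α P * ∏ q, blochFactor t (y q) (P q)| ≤ M)
    {m : ℕ} (hm : m ≤ k) (y : Fin n → Pauli → ℤˣ) :
    |∑ P with PauliString.weight P = m, α P * ∏ q ∈ P.support, ((y q (P q) : ℤ) : ℝ)|
      ≤ √3 ^ m * (2 ^ k * k ^ k / k.factorial * M) := by
  set p : Polynomial ℝ := ∑ P : PauliString n, Polynomial.monomial P.weight
    (α P * ((√3)⁻¹ ^ P.weight * ∏ q ∈ P.support, ((y q (P q) : ℤ) : ℝ))) with hp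
  have hdeg : p.natDegree ≤ k := by
    refine Polynomial.natDegree_sum_le_of_forall_le _ _ fun P _ => ?_
    by_cases hw : P.weight ≤ k
    · exact (Polynomial.natDegree_monomial_le _).trans hw
    · rw [hα P (not_le.mp hw)]; simp
  have heval : ∀ t : ℝ, |t| ≤ 1 → |p.eval t| ≤ M := by
    intro t ht
    refine le_trans (le_of_eq ?_) (hM t ht y)
    congr 1
    rw [hp, Polynomial.eval_finsetSum]
    refine Finset.sum_congr rfl fun P _ => ?_
    rw [Polynomial.eval_monomial, PauliString.prod_blochFactor]
    ring
  have h := abs_coeff_le_of_abs_eval_le hk hm hdeg heval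
  have hcoeff : ∑ P with PauliString.weight P = m, α P * ∏ q ∈ P.support, ((y q (P q) : ℤ) : ℝ)
      = √3 ^ m * p.coeff m := by
    rw [hp, Polynomial.finsetSum_coeff, Finset.sum_filter, Finset.mul_sum]
    refine Finset.sum_congr rfl fun P _ => ?_
    rw [Polynomial.coeff_monomial]
    split_ifs with hw
    · rw [hw, inv_pow]
      field_simp
    · simp
  rw [hcoeff, abs_mul, abs_of_nonneg (by positivity)]
  gcongr

/-- For every colouring of the qubits, the rainbow part of the polynomial in the Bloch vectors is a
bounded multilinear form. -/
lemma abs_sum_rainbow_le (hk : 1 ≤ k) (hα : ∀ P, k < P.weight → α P = 0)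
    (hM : ∀ t : ℝ, |t| ≤ 1 → ∀ y : Fin n → Pauli → ℤˣ,
      |∑ P, α P * ∏ q, blochFactor t (y q) (P q)| ≤ M)
    {m : ℕ} (hm : m ≤ k) (c : Fin n → Fin m) (x : Fin m → Fin n × Pauli → ℤˣ) :
    |∑ P ∈ PauliString.rainbow c, α P * ∏ q ∈ P.support, ((x (c q) (q, P q) : ℤ) : ℝ)|
      ≤ √3 ^ m * (2 ^ k * k ^ k / k.factorial * M) := by
  set K := √3 ^ m * (2 ^ k * k ^ k / k.factorial * M)
  have h1 : ∑ e : Fin m → ℤˣ, (∏ j, ((e j : ℤ) : ℝ)) *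
        ∑ P with PauliString.weight P = m, α P *
          ∏ q ∈ P.support, ((e (c q) * x (c q) (q, P q) : ℤˣ) : ℤ)
      = 2 ^ m * ∑ P ∈ PauliString.rainbow c,
          α P * ∏ q ∈ P.support, ((x (c q) (q, P q) : ℤ) : ℝ) := by
    simp only [Finset.mul_sum]
    rw [Finset.sum_comm, PauliString.rainbow, ← Finset.filter_filter]
    conv_rhs => rw [Finset.sum_filter]
    refine Finset.sum_congr rfl fun P hP => ?_
    have hw : P.support.card = m := (Finset.mem_filter.mp hP).2
    have h2 := sum_prod_sign_mul c hw
    calc _ = (∑ e : Fin m → ℤˣ, (∏ j, ((e j : ℤ) : ℝ)) * ∏ q ∈ P.support, ((e (c q) : ℤ) : ℝ))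
          * (α P * ∏ q ∈ P.support, ((x (c q) (q, P q) : ℤ) : ℝ)) := by
          rw [Finset.sum_mul]
          refine Finset.sum_congr rfl fun e _ => ?_
          push_cast
          rw [Finset.prod_mul_distrib]
          ring
      _ = _ := by
          rw [h2]
          split_ifs <;> simp
  have h2 : |2 ^ m * ∑ P ∈ PauliString.rainbow c,
      α P * ∏ q ∈ P.support, ((x (c q) (q, P q) : ℤ) : ℝ)| ≤ 2 ^ m * K := by
    rw [← h1]
    refine (Finset.abs_sum_le_sum_abs _ _).trans ?_
    have h3 : ∀ e ∈ (Finset.univ : Finset (Fin m → ℤˣ)), |(∏ j, ((e j : ℤ) : ℝ)) *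
        ∑ P with PauliString.weight P = m, α P *
          ∏ q ∈ P.support, ((e (c q) * x (c q) (q, P q) : ℤˣ) : ℤ)| ≤ K := by
      intro e _
      have h4 : |∏ j, ((e j : ℤ) : ℝ)| = 1 := by
        rw [Finset.abs_prod]
        refine Finset.prod_eq_one fun j _ => ?_
        rcases Int.units_eq_one_or (e j) with h | h <;> simp [h]
      rw [abs_mul, h4, one_mul]
      have := abs_sum_weight_eq_le hk hα hM hm fun q σ => e (c q) * x (c q) (q, σ)
      push_cast at this ⊢
      exact this
    refine (Finset.sum_le_card_nsmul _ _ _ h3).trans (le_of_eq ?_)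
    simp [Finset.card_univ]
  rw [abs_mul, abs_of_pos (by positivity)] at h2
  exact le_of_mul_le_mul_left h2 (by positivity)

/-- The Bohnenblust–Hille inequality for the coefficients of weight `m + 1`: the multilinear
inequality for the rainbow part of every colouring, averaged over the colourings. -/
lemma factorial_mul_sum_weight_eq_le (hk : 1 ≤ k) (hα : ∀ P, k < P.weight → α P = 0)
    (hM0 : 0 < M) (hM : ∀ t : ℝ, |t| ≤ 1 → ∀ y : Fin n → Pauli → ℤˣ,
      |∑ P, α P * ∏ q, blochFactor t (y q) (P q)| ≤ M)
    {m : ℕ} (hm : m + 1 ≤ k) {r : ℝ} (hr : 2 * ((m : ℝ) + 1) / ((m : ℝ) + 2) ≤ r) :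
    (m + 1).factorial * ∑ P with PauliString.weight P = m + 1, |α P| ^ r
      ≤ ((m + 1 : ℕ) : ℝ) ^ (m + 1)
        * (√2 ^ m * (√3 ^ (m + 1) * (2 ^ k * k ^ k / k.factorial * M))) ^ r := by
  set K := √3 ^ (m + 1) * (2 ^ k * k ^ k / k.factorial * M) with hK
  have hk0 : (0 : ℝ) < k := by exact_mod_cast hk
  have hK0 : 0 < K := by positivity
  have hr0 : 0 < r := lt_of_lt_of_le (by positivity) hr
  have hc : ∀ c : Fin n → Fin (m + 1), ∑ P ∈ PauliString.rainbow c, |α P| ^ r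
      ≤ (√2 ^ m * K) ^ r := by
    intro c
    let a : (Fin (m + 1) → Fin n × Pauli) → ℝ := fun i =>
      if PauliString.IsColoured c i then α (PauliString.ofColoured c i) else 0
    have hB : ∀ x : Fin (m + 1) → Fin n × Pauli → ℤˣ,
        |∑ i, a i * ∏ j, ((x j (i j) : ℤ) : ℝ)| ≤ K := by
      intro x
      refine le_trans (le_of_eq ?_) (abs_sum_rainbow_le hk hα hM hm c x)
      rw [PauliString.sum_rainbow]
      congr 1
      refine Finset.sum_congr rfl fun i _ => ?_
      simp only [a]
      split_ifs with hi
      · rw [hi.support_ofColoured, Finset.prod_image fun _ _ _ _ h => hi.injective_fst h]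
        congr 1
        refine Finset.prod_congr rfl fun j _ => ?_
        rw [hi.ofColoured_apply, (hi j).1]
      · simp
    refine le_trans (le_of_eq ?_) (bohnenblustHille_multilinear a hK0 hB hr)
    rw [PauliString.sum_rainbow]
    refine Finset.sum_congr rfl fun i _ => ?_
    simp only [a]
    split_ifs
    · rfl
    · rw [abs_zero, Real.zero_rpow hr0.ne']
  by_cases hn : m + 1 ≤ n
  · -- Double counting of the pairs of a colouring and a rainbow string.
    have h1 : ∑ c : Fin n → Fin (m + 1), ∑ P ∈ PauliString.rainbow c, |α P| ^ r
        ≤ ((m + 1 : ℕ) : ℝ) ^ n * (√2 ^ m * K) ^ r := by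
      refine (Finset.sum_le_card_nsmul _ _ _ fun c _ => hc c).trans (le_of_eq ?_)
      simp [Finset.card_univ]
    have h2 : (((m + 1).factorial * (m + 1) ^ (n - (m + 1)) : ℕ) : ℝ)
          * ∑ P with PauliString.weight P = m + 1, |α P| ^ r
        ≤ ∑ c : Fin n → Fin (m + 1), ∑ P ∈ PauliString.rainbow c, |α P| ^ r := by
      simp only [PauliString.rainbow, ← Finset.filter_filter]
      simp only [Finset.sum_filter (fun P : PauliString n => Finset.image _ P.support = _)]
      rw [Finset.sum_comm, Finset.mul_sum]
      refine Finset.sum_le_sum fun P hP => ?_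
      have hw : P.support.card = m + 1 := (Finset.mem_filter.mp hP).2
      rw [← Finset.sum_filter, Finset.sum_const, nsmul_eq_mul]
      gcongr
      exact PauliString.le_card_rainbow_colourings hw
    have h3 := h2.trans h1
    have h4 : ((m + 1 : ℕ) : ℝ) ^ n
        = ((m + 1 : ℕ) : ℝ) ^ (n - (m + 1)) * ((m + 1 : ℕ) : ℝ) ^ (m + 1) := by
      rw [← pow_add]; congr 1; omega
    rw [h4, Nat.cast_mul, Nat.cast_pow] at h3
    have h5 : (0 : ℝ) < ((m + 1 : ℕ) : ℝ) ^ (n - (m + 1)) := by positivity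
    refine le_of_mul_le_mul_left (le_trans (le_of_eq ?_) (h3.trans (le_of_eq ?_))) h5 <;> ring
  · -- There are no strings of weight larger than the number of qubits.
    rw [Finset.sum_eq_zero]
    · rw [mul_zero]; positivity
    · intro P hP
      have hw : P.support.card = m + 1 := (Finset.mem_filter.mp hP).2
      have := Finset.card_le_univ P.support
      rw [Fintype.card_fin] at this
      omega

end Decoupling

/-! ### The Bohnenblust–Hille inequality for local Hamiltonians -/

lemma pow_self_div_factorial_mono : Monotone fun m : ℕ => (m : ℝ) ^ m / m.factorial := by
  refine monotone_nat_of_le_succ fun m => ?_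
  rw [div_le_div_iff₀ (by positivity) (by positivity), Nat.factorial_succ, pow_succ]
  have : (m : ℝ) ^ m ≤ ((m + 1 : ℕ) : ℝ) ^ m := by gcongr; simp
  have h0 : (0 : ℝ) ≤ m.factorial := by positivity
  push_cast at this ⊢
  nlinarith [mul_le_mul_of_nonneg_right this (show (0 : ℝ) ≤ (m + 1) * m.factorial by positivity)]

lemma one_le_pow_self_div_factorial (m : ℕ) : 1 ≤ (m : ℝ) ^ m / m.factorial := by
  simpa using pow_self_div_factorial_mono (Nat.zero_le m)

/-- The Bohnenblust–Hille inequality with the constant that the proof gives. Each of the `k + 1`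
weights contributes at most `T ^ r` to the sum of the `r`-th powers; for smaller weights this uses
that the critical exponent increases with the weight. -/
lemma pauliNorm_le {n k : ℕ} (hk : 1 ≤ k) {H : QubitOp n} (hH : IsLocalHamiltonian k H) {M : ℝ}
    (hM0 : 0 < M) (hM : spectralNormOp H ≤ M) :
    pauliNorm (2 * (k : ℝ) / ((k : ℝ) + 1)) H
      ≤ (k + 1) * ((k : ℝ) ^ k / k.factorial * √6 ^ k * (2 ^ k * k ^ k / k.factorial) * M) := by
  set r := 2 * (k : ℝ) / ((k : ℝ) + 1) with hr
  set T := (k : ℝ) ^ k / k.factorial * √6 ^ k * (2 ^ k * k ^ k / k.factorial) * M with hT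
  have hk0 : (0 : ℝ) < k := by exact_mod_cast hk
  have hk1 : (1 : ℝ) ≤ k := by exact_mod_cast hk
  have hr1 : 1 ≤ r := by rw [hr, le_div_iff₀ (by positivity)]; linarith
  have hr0 : 0 < r := by linarith
  have hT0 : 0 < T := by positivity
  set α : PauliString n → ℝ := fun P => (pauliCoeff H P).re with hα
  have hco : ∀ P, pauliCoeff H P = (α P : ℂ) := pauliCoeff_eq_re hH.1
  have hα0 : ∀ P, k < P.weight → α P = 0 := by
    intro P hP
    simp [hα, pauliCoeff_eq_zero_of_lt_weight hH hP]
  have hF : ∀ t : ℝ, |t| ≤ 1 → ∀ y : Fin n → Pauli → ℤˣ,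
      |∑ P, α P * ∏ q, blochFactor t (y q) (P q)| ≤ M := by
    intro t ht y
    refine le_trans (le_of_eq ?_) ((norm_sum_pauliCoeff_mul_le H ht y).trans hM)
    rw [← Real.norm_eq_abs, ← Complex.norm_real]
    push_cast
    simp only [hco]
  have hs6 : (1 : ℝ) ≤ √6 := Real.one_le_sqrt.mpr (by norm_num)
  have hlevel : ∀ m ∈ Finset.range (k + 1),
      ∑ P with PauliString.weight P = m, |α P| ^ r ≤ T ^ r := by
    intro m hm
    have hmk : m ≤ k := Nat.lt_succ_iff.mp (Finset.mem_range.mp hm)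
    rcases m with _ | m
    · have h0 : (Finset.univ.filter fun P : PauliString n => P.weight = 0)
          = {fun _ => Pauli.I} := by
        ext P
        simp [PauliString.weight, Finset.filter_eq_empty_iff, funext_iff]
      have h1 := abs_sum_weight_eq_le hk hα0 hF (Nat.zero_le k) fun _ _ => 1
      rw [h0] at h1 ⊢
      rw [Finset.sum_singleton] at h1 ⊢
      have h2 : |α fun _ => Pauli.I| ≤ 2 ^ k * k ^ k / k.factorial * M := by
        simpa using h1
      refine Real.rpow_le_rpow (abs_nonneg _) (h2.trans ?_) hr0.le
      rw [hT, mul_assoc]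
      refine le_mul_of_one_le_left (by positivity) ?_
      exact one_le_mul_of_one_le_of_one_le (one_le_pow_self_div_factorial k) (one_le_pow₀ hs6)
    · have hmr : 2 * ((m : ℝ) + 1) / ((m : ℝ) + 2) ≤ r := by
        have : (m : ℝ) + 1 ≤ k := by exact_mod_cast hmk
        rw [hr, div_le_div_iff₀ (by positivity) (by positivity)]
        nlinarith
      have h1 := factorial_mul_sum_weight_eq_le hk hα0 hM0 hF hmk hmr
      set S := √2 ^ m * (√3 ^ (m + 1) * (2 ^ k * k ^ k / k.factorial * M)) with hS
      set Q : ℝ := ((m + 1 : ℕ) : ℝ) ^ (m + 1) / (m + 1).factorial with hQ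
      have hQ1 : 1 ≤ Q := one_le_pow_self_div_factorial (m + 1)
      have hS0 : 0 < S := by positivity
      have h2 : √2 ^ m * √3 ^ (m + 1) ≤ √6 ^ k := by
        have h6 : √6 = √2 * √3 := by rw [← Real.sqrt_mul (by norm_num)]; norm_num
        calc √2 ^ m * √3 ^ (m + 1) ≤ √2 ^ (m + 1) * √3 ^ (m + 1) := by
              gcongr
              · exact Real.one_le_sqrt.mpr (by norm_num)
              · omega
          _ = √6 ^ (m + 1) := by rw [h6, mul_pow]
          _ ≤ √6 ^ k := pow_le_pow_right₀ hs6 hmk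
      calc ∑ P with PauliString.weight P = m + 1, |α P| ^ r ≤ Q * S ^ r := by
            rw [hQ, div_mul_eq_mul_div, le_div_iff₀ (by positivity)]
            linarith
        _ ≤ Q ^ r * S ^ r := by
            gcongr
            exact Real.self_le_rpow_of_one_le hQ1 hr1
        _ = (Q * S) ^ r := (Real.mul_rpow (by positivity) hS0.le).symm
        _ ≤ T ^ r := by
            refine Real.rpow_le_rpow (by positivity) ?_ hr0.le
            have h3 : Q ≤ (k : ℝ) ^ k / k.factorial := pow_self_div_factorial_mono hmk
            calc Q * S = Q * (√2 ^ m * √3 ^ (m + 1)) * (2 ^ k * k ^ k / k.factorial) * M := by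
                  rw [hS]; ring
              _ ≤ T := by rw [hT]; gcongr
  have hsum : ∑ P : PauliString n, ‖pauliCoeff H P‖ ^ r ≤ (k + 1) * T ^ r := by
    calc ∑ P : PauliString n, ‖pauliCoeff H P‖ ^ r
        = ∑ P : PauliString n, ∑ m ∈ Finset.range (k + 1),
            if P.weight = m then |α P| ^ r else 0 := by
          refine Finset.sum_congr rfl fun P _ => ?_
          rw [hco, Complex.norm_real, Real.norm_eq_abs, Finset.sum_ite_eq]
          split_ifs with h
          · rfl
          · rw [hα0 P (by simpa using h), abs_zero, Real.zero_rpow hr0.ne']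
      _ = ∑ m ∈ Finset.range (k + 1), ∑ P with PauliString.weight P = m, |α P| ^ r := by
          rw [Finset.sum_comm]
          simp only [Finset.sum_filter]
      _ ≤ (k + 1) * T ^ r := by
          refine (Finset.sum_le_card_nsmul _ _ _ hlevel).trans (le_of_eq ?_)
          simp
  calc pauliNorm r H ≤ ((k + 1) * T ^ r) ^ (1 / r) := by
        unfold pauliNorm
        refine Real.rpow_le_rpow (Finset.sum_nonneg fun P _ => by positivity) hsum (by positivity)
    _ = ((k : ℝ) + 1) ^ (1 / r) * T := by
        rw [Real.mul_rpow (by positivity) (by positivity), ← Real.rpow_mul hT0.le,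
          mul_one_div_cancel hr0.ne', Real.rpow_one]
    _ ≤ (k + 1) * T := by
        gcongr
        exact Real.rpow_le_self_of_one_le (by linarith) ((div_le_one hr0).mpr hr1)

/-! ### The constant -/

/-- The inductive step needs `(1 + 1 / k) ^ (2 * k) ≤ (k + 1) ^ 3 / k ^ 2`; the left side is at most
`exp 2 < 8`, which suffices from `k = 5` on. -/
lemma pow_two_mul_self_le {k : ℕ} (hk : 1 ≤ k) :
    (k : ℝ) ^ (2 * k) ≤ 4 * k ^ 2 * (k.factorial : ℝ) ^ 3 := by
  by_cases h5 : k < 5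
  · interval_cases k <;> norm_num [Nat.factorial]
  · induction k, not_lt.mp h5 using Nat.le_induction with
    | base => norm_num [Nat.factorial]
    | succ k h5k ih =>
      have ih := ih (by omega) (by omega)
      have hk5 : (5 : ℝ) ≤ k := by exact_mod_cast h5k
      have hk0 : (0 : ℝ) < k := by linarith
      have h1 : ((k : ℝ) + 1) ^ (2 * k) ≤ 8 * k ^ (2 * k) := by
        have he : (1 + 1 / (k : ℝ)) ^ k ≤ Real.exp 1 := by
          calc (1 + 1 / (k : ℝ)) ^ k ≤ Real.exp (1 / k) ^ k := by
                gcongr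
                linarith [Real.add_one_le_exp (1 / (k : ℝ))]
            _ = Real.exp 1 := by
                rw [← Real.exp_nat_mul]; congr 1; field_simp
        have he8 : Real.exp 1 ^ 2 ≤ 8 := by
          nlinarith [Real.exp_one_lt_d9, Real.exp_pos 1]
        have h2 : ((k : ℝ) + 1) ^ (2 * k) = ((1 + 1 / (k : ℝ)) ^ k) ^ 2 * k ^ (2 * k) := by
          rw [← pow_mul, mul_comm k 2, ← mul_pow]
          congr 1
          field_simp
        rw [h2]
        gcongr
        exact (pow_le_pow_left₀ (by positivity) he 2).trans he8
      have h3 : 8 * (k : ℝ) ^ 2 ≤ (k + 1) ^ 3 := by nlinarith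
      rw [Nat.factorial_succ]
      push_cast
      have hf : (0 : ℝ) < k.factorial := by positivity
      calc ((k : ℝ) + 1) ^ (2 * (k + 1)) = (k + 1) ^ (2 * k) * (k + 1) ^ 2 := by ring
        _ ≤ 8 * (4 * k ^ 2 * (k.factorial : ℝ) ^ 3) * (k + 1) ^ 2 := by
            gcongr
            exact h1.trans (by gcongr)
        _ = 4 * (8 * (k : ℝ) ^ 2) * (k.factorial : ℝ) ^ 3 * (k + 1) ^ 2 := by ring
        _ ≤ 4 * (k + 1) ^ 3 * (k.factorial : ℝ) ^ 3 * (k + 1) ^ 2 := by gcongr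
        _ = _ := by ring

lemma bhConst_pos {k : ℕ} (hk : 1 ≤ k) : 0 < bhConst k := by
  have hk0 : (0 : ℝ) < k := by exact_mod_cast hk
  unfold bhConst
  positivity

/-- The constant obtained in `pauliNorm_le` is at most `3 / bhConst k`. -/
lemma bhConst_mul_le {k : ℕ} (hk : 1 ≤ k) :
    1 / 3 * bhConst k
      * ((k + 1) * ((k : ℝ) ^ k / k.factorial * √6 ^ k * (2 ^ k * k ^ k / k.factorial))) ≤ 1 := by
  have hk0 : (0 : ℝ) < k := by exact_mod_cast hk
  have hk1 : (1 : ℝ) ≤ k := by exact_mod_cast hk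
  have hf : (0 : ℝ) < k.factorial := by positivity
  set D := (k : ℝ) ^ ((k : ℝ) + 3 / 2 + ((k : ℝ) + 1) / (2 * (k : ℝ))) with hD
  have hDk : (k : ℝ) ^ (k + 2) ≤ D := by
    rw [← Real.rpow_natCast, hD]
    refine Real.rpow_le_rpow_of_exponent_le hk1 ?_
    have : 1 / 2 ≤ ((k : ℝ) + 1) / (2 * (k : ℝ)) := by
      rw [div_le_div_iff₀ (by norm_num) (by positivity)]; linarith
    push_cast
    linarith
  have hs : 2 ^ k * √6 ^ k ≤ (√6 + 2 * √3) ^ k := by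
    rw [← mul_pow]
    have h1 : √6 ≤ 2 * √3 := by
      rw [show (2 : ℝ) * √3 = √12 by
        rw [show (12 : ℝ) = 2 ^ 2 * 3 by norm_num, Real.sqrt_mul (by norm_num),
          Real.sqrt_sq (by norm_num)]]
      exact Real.sqrt_le_sqrt (by norm_num)
    gcongr
    linarith
  have hroot : √(2 * (k.factorial : ℝ)) * (k + 1) * k ^ k ≤ 6 * k ^ 2 * (k.factorial : ℝ) ^ 2 := by
    refine le_of_sq_le_sq ?_ (by positivity)
    rw [mul_pow, mul_pow, Real.sq_sqrt (by positivity), ← pow_mul, mul_comm k 2]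
    have h1 := pow_two_mul_self_le hk
    calc 2 * (k.factorial : ℝ) * (k + 1) ^ 2 * k ^ (2 * k)
        ≤ 2 * (k.factorial : ℝ) * (k + k) ^ 2 * (4 * k ^ 2 * (k.factorial : ℝ) ^ 3) := by gcongr
      _ = 32 * (k ^ 4 * (k.factorial : ℝ) ^ 4) := by ring
      _ ≤ 36 * (k ^ 4 * (k.factorial : ℝ) ^ 4) := by gcongr; norm_num
      _ = _ := by ring
  have hnum : √(2 * (k.factorial : ℝ)) * (k + 1) * k ^ k * (k ^ k * (2 ^ k * √6 ^ k))
      ≤ 6 * (k.factorial : ℝ) ^ 2 * (D * (√6 + 2 * √3) ^ k) := by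
    calc _ ≤ 6 * k ^ 2 * (k.factorial : ℝ) ^ 2 * (k ^ k * (√6 + 2 * √3) ^ k) := by gcongr
      _ = 6 * (k.factorial : ℝ) ^ 2 * (k ^ (k + 2) * (√6 + 2 * √3) ^ k) := by ring
      _ ≤ _ := by gcongr
  have hden : 0 < 6 * (k.factorial : ℝ) ^ 2 * (D * (√6 + 2 * √3) ^ k) := by positivity
  rw [← div_le_one hden] at hnum
  refine le_trans (le_of_eq ?_) hnum
  unfold bhConst
  rw [← hD]
  field_simp
  ring

lemma neg_log_bhConst {k : ℕ} (hk : 1 ≤ k) :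
    -Real.log (bhConst k) = Real.log 2
      + ((k : ℝ) + 3 / 2 + ((k : ℝ) + 1) / (2 * (k : ℝ))) * Real.log k
      + k * Real.log (√6 + 2 * √3) - (Real.log 2 + Real.log k.factorial) / 2 := by
  have hk0 : (0 : ℝ) < k := by exact_mod_cast hk
  have hf : (0 : ℝ) < k.factorial := by positivity
  have hs : 0 < √6 + 2 * √3 := by positivity
  unfold bhConst
  rw [Real.log_div (by positivity) (by positivity), Real.log_sqrt (by positivity),
    Real.log_mul (by norm_num) hf.ne', Real.log_mul (by positivity) (by positivity),
    Real.log_mul (by norm_num) (by positivity), Real.log_rpow hk0, Real.log_pow]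
  ring

/-- The constant decays like `exp (-Θ(k log k))`. -/
lemma isTheta_neg_log_bhConst :
    Asymptotics.IsTheta Filter.atTop (fun k : ℕ => -Real.log (bhConst k))
      (fun k : ℕ => (k : ℝ) * Real.log (k : ℝ)) := by
  have hs1 : 1 ≤ √6 + 2 * √3 := by
    have : (1 : ℝ) ≤ √6 := Real.one_le_sqrt.mpr (by norm_num)
    linarith [Real.sqrt_nonneg 3]
  have hs0 : 0 ≤ Real.log (√6 + 2 * √3) := Real.log_nonneg hs1
  have hl2 : 0 ≤ Real.log 2 := Real.log_nonneg (by norm_num)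
  have hl2' : Real.log 2 ≤ 1 := by linarith [Real.log_two_lt_d9]
  set L := Real.log (√6 + 2 * √3) with hL
  have hbd : ∀ k : ℕ, 3 ≤ k →
      1 / 2 * ((k : ℝ) * Real.log k) ≤ -Real.log (bhConst k) ∧
      -Real.log (bhConst k) ≤ (5 + L) * ((k : ℝ) * Real.log k) := by
    intro k hk
    have hk3 : (3 : ℝ) ≤ k := by exact_mod_cast hk
    have hlog : 1 ≤ Real.log k := by
      rw [Real.le_log_iff_exp_le (by linarith)]
      linarith [Real.exp_one_lt_d9]
    have hfl : 0 ≤ Real.log k.factorial := Real.log_natCast_nonneg _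
    have hfu : Real.log k.factorial ≤ k * Real.log k := by
      rw [← Real.log_pow]
      refine Real.log_le_log (by positivity) ?_
      exact_mod_cast Nat.factorial_le_pow k
    have hq0 : 0 ≤ ((k : ℝ) + 1) / (2 * (k : ℝ)) := by positivity
    have hq1 : ((k : ℝ) + 1) / (2 * (k : ℝ)) ≤ 1 := by
      rw [div_le_one (by positivity)]; linarith
    have hkl : 0 ≤ (k : ℝ) * Real.log k := by positivity
    rw [neg_log_bhConst (by omega), ← hL]
    constructor
    · nlinarith [mul_nonneg hq0 (by linarith : (0 : ℝ) ≤ Real.log k),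
        mul_nonneg (by linarith : (0 : ℝ) ≤ (k : ℝ)) hs0]
    · have h1 : ((k : ℝ) + 1) / (2 * (k : ℝ)) * Real.log k ≤ k * Real.log k := by
        gcongr; linarith
      have h2 : (k : ℝ) * L ≤ L * (k * Real.log k) := by
        have := mul_le_mul_of_nonneg_left hlog (mul_nonneg hs0 (by linarith : (0 : ℝ) ≤ k))
        linarith
      have h3 : 3 / 2 * Real.log k ≤ k * Real.log k := by gcongr; linarith
      have h4 : Real.log 2 ≤ k * Real.log k := by nlinarith
      linarith
  refine ⟨Asymptotics.IsBigO.of_bound (5 + L) ?_, Asymptotics.IsBigO.of_bound 2 ?_⟩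
  all_goals
    filter_upwards [Filter.eventually_ge_atTop 3] with k hk
    obtain ⟨h1, h2⟩ := hbd k hk
    have hk0 : 0 ≤ (k : ℝ) * Real.log k :=
      mul_nonneg (Nat.cast_nonneg k) (Real.log_natCast_nonneg k)
    have hg0 : 0 ≤ -Real.log (bhConst k) := by linarith
    rw [Real.norm_of_nonneg hk0, Real.norm_of_nonneg hg0]
    linarith

theorem mainTheorem2 :
    (∃ g : ℕ → ℝ,
      Asymptotics.IsTheta Filter.atTop g (fun k : ℕ => (k : ℝ) * Real.log (k : ℝ)) ∧
      ∀ k : ℕ, 1 ≤ k → bhConst k = 1 / Real.exp (g k)) ∧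
    ∀ (n k : ℕ), 1 ≤ k → ∀ H : QubitOp n, IsLocalHamiltonian k H →
      1 / 3 * bhConst k * pauliNorm (2 * (k : ℝ) / ((k : ℝ) + 1)) H ≤ spectralNormOp H := by
  refine ⟨⟨fun k => -Real.log (bhConst k), isTheta_neg_log_bhConst, fun k hk => ?_⟩, ?_⟩
  · rw [Real.exp_neg, Real.exp_log (bhConst_pos hk), one_div, inv_inv]
  · intro n k hk H hH
    -- Strict upper bounds `M` of the norm are positive, also when `H = 0`.
    refine le_of_forall_gt_imp_ge_of_dense fun M hM => ?_
    have hM0 : 0 < M := lt_of_le_of_lt (norm_nonneg _) hM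
    have hC : 0 < 1 / 3 * bhConst k := mul_pos (by norm_num) (bhConst_pos hk)
    calc 1 / 3 * bhConst k * pauliNorm (2 * (k : ℝ) / ((k : ℝ) + 1)) H
        ≤ 1 / 3 * bhConst k * ((k + 1) * ((k : ℝ) ^ k / k.factorial * √6 ^ k
            * (2 ^ k * k ^ k / k.factorial) * M)) :=
          mul_le_mul_of_nonneg_left (pauliNorm_le hk hH hM0 hM.le) hC.le
      _ = 1 / 3 * bhConst k * ((k + 1) * ((k : ℝ) ^ k / k.factorial * √6 ^ k
            * (2 ^ k * k ^ k / k.factorial))) * M := by ring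
      _ ≤ 1 * M := by
          gcongr
          exact bhConst_mul_le hk
      _ = M := one_mul M
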